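/- Let $X$ be a completely regular Hausdorff space and $\beta X$ its Stone–Čech compactification. $C(X)$ is the ring of continuous functions $X\to\mathbb R$. For a family $\mathcal S$ of dense subsets of a space $Y$ that contains $Y$ and is closed under finite intersection, let $C[\mathcal S]=\varinjlim_{S\in\mathcal S}C(S)$ be the ring of continuous real functions defined on members of $\mathcal S$, two functions being identified when they agree on the intersection of their domains; it is a lattice-ordered ring under the pointwise order and a metric space under $d(f,g)=\sup\frac{|f-g|}{1+|f-g|}$. Put - $Q(X)=C[\mathcal V_0(X)]$, with $\mathcal V_0(X)$ the family of dense open subsets of $X$; restriction identifies $Q(\beta X)$ with $Q(X)$; - $\overline Q(X)=C[\mathcal G_0(\beta X)]$, with $\mathcal G_0(\beta X)$ the family of dense $G_\delta$ subsets of $\beta X$; thus $C(X)\subset Q(X)=Q(\beta X)\subset\overline Q(X)$; - $Q_L(X)$ (resp. $Q_F(X)$): the subring of those elements of $Q(X)$ that are represented by a locally constant continuous function (resp. a continuous function with finite range) on a dense open subset of $X$; - $C^*(X)$, $Q^*(X)$, $\overline Q^*(X)$: the subrings of bounded elements of $C(X)$, $Q(X)$, $\overline Q(X)$. An element $h\in\overline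 Q(X)$ is *$C$-bounded* if $|h|\le g$ for some $g\in C(X)$. An ordered ring $B$ is the *Dedekind completion* of a subring $A$ (with the induced order) if every nonempty subset of $B$ with an upper bound in $B$ has a supremum in $B$ and every element of $B$ is the supremum in $B$ of some subset of $A$. A commutative ring $B$ is a *ring of quotients* of a subring $A$ with the same unity if for all $b,b'\in B$ with $b'\neq0$ there is $a\in A$ with $ba\in A$ and $b'a\ne0$; it is the *maximal* one if every ring of quotients of $A$ embeds in $B$ over $A$. Theorem. 1. $Q(X)$ is the maximal ring of quotients of $C(X)$, and $\overline Q(X)$ is the metric completion of $Q(X)$ (the inclusion is isometric with dense image, and $\overline Q(X)$ is complete). 2. $\overline Q(X)$ is the Dedekind completion of $Q_L(X)$ and of $Q(X)$. 3. $\overline Q^*(X)$ is the Dedekind completion of $Q_F(X)$ and of $Q^*(X)$. 4. The $C$-bounded elements of $\overline Q(X)$ form a subring, which is the Dedekind completion of $C(X)$; and $\overline Q^*(X)$ is the Dedekind completion of $C^*(X)$. -/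

import Mathlib

namespace RingsOfFunctions

universe u

noncomputable section

/-! ### Direct limits of rings of continuous functions on dense sets -/

/-- A filter base of dense subsets of `Y` (containing the whole space `Y`). -/
structure DenseFilterBase (Y : Type u) [TopologicalSpace Y] where
  sets : Set (Set Y)
  univ_mem : Set.univ ∈ sets
  inter_mem : ∀ {S T : Set Y}, S ∈ sets → T ∈ sets → S ∩ T ∈ sets
  dense : ∀ {S : Set Y}, S ∈ sets → Dense S

/-- The base of all dense open subsets of `Y`. -/
def denseOpen (Y : Type u) [TopologicalSpace Y] : DenseFilterBase Y where
  sets := {S | IsOpen S ∧ Dense S}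
  univ_mem := ⟨isOpen_univ, dense_univ⟩
  inter_mem hS hT := ⟨hS.1.inter hT.1, hS.2.inter_of_isOpen_left hT.2 hS.1⟩
  dense hS := hS.2

/-- The base of all dense `G_δ` subsets of the Baire space `Y`. -/
def denseGdelta (Y : Type u) [TopologicalSpace Y] [BaireSpace Y] : DenseFilterBase Y where
  sets := {S | IsGδ S ∧ Dense S}
  univ_mem := ⟨IsGδ.univ, dense_univ⟩
  inter_mem hS hT := ⟨hS.1.inter hT.1, Dense.inter_of_Gδ hS.1 hT.1 hS.2 hT.2⟩
  dense hS := hS.2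

/-- The members of a base `𝓢`, directed by reverse inclusion. -/
structure Stage {Y : Type u} [TopologicalSpace Y] (𝓢 : DenseFilterBase Y) where
  carrier : Set Y
  mem : carrier ∈ 𝓢.sets

section

variable {Y : Type u} [TopologicalSpace Y] {𝓢 : DenseFilterBase Y}

instance : Preorder (Stage 𝓢) where
  le i j := j.carrier ⊆ i.carrier
  le_refl _ := subset_rfl
  le_trans _ _ _ h h' := h'.trans h

instance : Nonempty (Stage 𝓢) := ⟨⟨Set.univ, 𝓢.univ_mem⟩⟩

instance : IsDirectedOrder (Stage 𝓢) where
  directed i j := ⟨⟨i.carrier ∩ j.carrier, 𝓢.inter_mem i.mem j.mem⟩,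
    Set.inter_subset_left, Set.inter_subset_right⟩

/-- Restriction `C(S) → C(S')` for members `S ⊇ S'` of the base. -/
def res (i j : Stage 𝓢) (h : i ≤ j) : C(i.carrier, ℝ) →+* C(j.carrier, ℝ) where
  toFun f := f.comp ⟨Set.inclusion h, continuous_inclusion h⟩
  map_one' := rfl
  map_mul' _ _ := rfl
  map_zero' := rfl
  map_add' _ _ := rfl

instance : DirectedSystem (fun i : Stage 𝓢 => C(i.carrier, ℝ)) (fun i j h => res i j h) where
  map_self _ _ := rfl
  map_map _ _ _ _ _ _ := rfl

variable (𝓢) in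
/-- The ring `C[𝓢]`, the direct limit of the rings `C(S)`, `S ∈ 𝓢`, along restriction. -/
def LimitRing : Type u := DirectLimit (fun i : Stage 𝓢 => C(i.carrier, ℝ)) res

namespace LimitRing

instance : CommRing (LimitRing 𝓢) :=
  inferInstanceAs (CommRing (DirectLimit (fun i : Stage 𝓢 => C(i.carrier, ℝ)) res))

/-- The element of `C[𝓢]` represented by a continuous function on a member of `𝓢`. -/
def mk (i : Stage 𝓢) (f : C(i.carrier, ℝ)) : LimitRing 𝓢 :=
  (⟦⟨i, f⟩⟧ : DirectLimit (fun i : Stage 𝓢 => C(i.carrier, ℝ)) res)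

theorem mk_res {i j : Stage 𝓢} (h : i ≤ j) (f : C(i.carrier, ℝ)) : mk j (res i j h f) = mk i f :=
  DirectLimit.mk_apply (F := fun i : Stage 𝓢 => C(i.carrier, ℝ)) (f := res) i j f h

theorem denseRange_inclusion {i j : Stage 𝓢} (h : i ≤ j) :
    DenseRange (Set.inclusion h : j.carrier → i.carrier) := by
  rw [DenseRange, Subtype.dense_iff]
  intro x _
  have : (Subtype.val '' Set.range (Set.inclusion h) : Set Y) = j.carrier := by
    ext y; constructor
    · rintro ⟨_, ⟨z, rfl⟩, rfl⟩; exact z.2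
    · intro hy; exact ⟨_, ⟨⟨y, hy⟩, rfl⟩, rfl⟩
  rw [this]
  exact 𝓢.dense j.mem x

theorem res_le_res {i j : Stage 𝓢} (h : i ≤ j) {f g : C(i.carrier, ℝ)} :
    res i j h f ≤ res i j h g ↔ f ≤ g := by
  refine ⟨fun H x => ?_, fun H x => H _⟩
  have hc : IsClosed {x | f x ≤ g x} := isClosed_le f.continuous g.continuous
  exact (denseRange_inclusion h).induction_on (p := fun x => f x ≤ g x) x hc fun a => H a

theorem res_injective (i j : Stage 𝓢) (h : i ≤ j) : Function.Injective (res i j h) :=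
  fun _ _ H => le_antisymm ((res_le_res h).1 H.le) ((res_le_res h).1 H.ge)

theorem mk_injective (i : Stage 𝓢) : Function.Injective (mk i) :=
  DirectLimit.mk_injective _ res_injective i

theorem ind {p : LimitRing 𝓢 → Prop} (h : ∀ i f, p (mk i f)) (a : LimitRing 𝓢) : p a :=
  DirectLimit.induction _ h a

theorem ind₂ {p : LimitRing 𝓢 → LimitRing 𝓢 → Prop} (h : ∀ i f g, p (mk i f) (mk i g))
    (a b : LimitRing 𝓢) : p a b :=
  DirectLimit.induction₂ _ h a b

theorem ind₃ {p : LimitRing 𝓢 → LimitRing 𝓢 → LimitRing 𝓢 → Prop}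
    (h : ∀ i f g k, p (mk i f) (mk i g) (mk i k)) (a b c : LimitRing 𝓢) : p a b c :=
  DirectLimit.induction₃ _ h a b c

theorem mk_add (i : Stage 𝓢) (f g) : mk i f + mk i g = mk i (f + g) := DirectLimit.add_def ..
theorem mk_mul (i : Stage 𝓢) (f g) : mk i f * mk i g = mk i (f * g) := DirectLimit.mul_def ..
theorem mk_neg (i : Stage 𝓢) (f) : -mk i f = mk i (-f) := rfl
theorem mk_zero (i : Stage 𝓢) : mk i 0 = 0 := (DirectLimit.zero_def i).symm
theorem mk_one (i : Stage 𝓢) : mk i 1 = 1 := (DirectLimit.one_def i).symm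
theorem mk_natCast (i : Stage 𝓢) (n : ℕ) : mk i n = n := (DirectLimit.natCast_def n i).symm

/-- The pointwise order: `a ≤ b` when `f ≤ g` for some representatives `f` of `a` and `g` of `b`
on a common member of the base. -/
instance : LE (LimitRing 𝓢) where
  le a b := ∃ (i : Stage 𝓢) (f g : C(i.carrier, ℝ)), a = mk i f ∧ b = mk i g ∧ f ≤ g

theorem mk_le_mk {i : Stage 𝓢} {f g : C(i.carrier, ℝ)} : mk i f ≤ mk i g ↔ f ≤ g := by
  constructor
  · rintro ⟨j, f', g', hf, hg, H⟩
    obtain ⟨k, hi, hj⟩ := exists_ge_ge i j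
    rw [← mk_res hi, ← mk_res hj] at hf hg
    rw [← res_le_res hi, mk_injective k hf, mk_injective k hg, res_le_res hj]
    exact H
  · intro H; exact ⟨i, f, g, rfl, rfl, H⟩

instance : Max (LimitRing 𝓢) where
  max := DirectLimit.map₂ res res res (fun _ f g => f ⊔ g) fun _ _ _ _ _ => rfl

instance : Min (LimitRing 𝓢) where
  min := DirectLimit.map₂ res res res (fun _ f g => f ⊓ g) fun _ _ _ _ _ => rfl

theorem mk_sup (i : Stage 𝓢) (f g) : mk i f ⊔ mk i g = mk i (f ⊔ g) := DirectLimit.map₂_def ..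
theorem mk_inf (i : Stage 𝓢) (f g) : mk i f ⊓ mk i g = mk i (f ⊓ g) := DirectLimit.map₂_def ..

instance : Lattice (LimitRing 𝓢) where
  le_refl := ind fun _ _ => mk_le_mk.2 le_rfl
  le_trans := ind₃ fun _ _ _ _ h h' => mk_le_mk.2 ((mk_le_mk.1 h).trans (mk_le_mk.1 h'))
  le_antisymm := ind₂ fun _ _ _ h h' =>
    congrArg _ (le_antisymm (mk_le_mk.1 h) (mk_le_mk.1 h'))
  sup := (· ⊔ ·)
  inf := (· ⊓ ·)
  le_sup_left := ind₂ fun _ _ _ => by rw [mk_sup, mk_le_mk]; exact le_sup_left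
  le_sup_right := ind₂ fun _ _ _ => by rw [mk_sup, mk_le_mk]; exact le_sup_right
  sup_le := ind₃ fun _ _ _ _ => by
    rw [mk_sup, mk_le_mk, mk_le_mk, mk_le_mk]; exact sup_le
  inf_le_left := ind₂ fun _ _ _ => by rw [mk_inf, mk_le_mk]; exact inf_le_left
  inf_le_right := ind₂ fun _ _ _ => by rw [mk_inf, mk_le_mk]; exact inf_le_right
  le_inf := ind₃ fun _ _ _ _ => by
    rw [mk_inf, mk_le_mk, mk_le_mk, mk_le_mk]; exact le_inf

instance : IsOrderedRing (LimitRing 𝓢) where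
  add_le_add_left := fun a b h c => by
    induction a, b, c using ind₃ with | h i f g k => ?_
    rw [mk_add, mk_add, mk_le_mk]
    exact fun x => add_le_add_left (mk_le_mk.1 h x) _
  zero_le_one := by
    obtain ⟨i⟩ : Nonempty (Stage 𝓢) := inferInstance
    rw [← mk_zero i, ← mk_one i, mk_le_mk]
    exact fun x => zero_le_one
  mul_le_mul_of_nonneg_left := fun a ha b c h => by
    induction a, b, c using ind₃ with | h i f g k => ?_
    rw [← mk_zero i, mk_le_mk] at ha
    simp only [mk_mul, mk_le_mk] at h ⊢
    exact fun x => mul_le_mul_of_nonneg_left (h x) (ha x)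
  mul_le_mul_of_nonneg_right := fun a ha b c h => by
    induction a, b, c using ind₃ with | h i f g k => ?_
    rw [← mk_zero i, mk_le_mk] at ha
    simp only [mk_mul, mk_le_mk] at h ⊢
    exact fun x => mul_le_mul_of_nonneg_right (h x) (ha x)

/-! The metric `‖(f - g) / (1 + |f - g|)‖` (sup norm) on `C[𝓢]`. -/

/-- The supremum of `|f - g| / (1 + |f - g|)` over `S`. -/
def stageDist (i : Stage 𝓢) (f g : C(i.carrier, ℝ)) : ℝ :=
  ⨆ x : i.carrier, |f x - g x| / (1 + |f x - g x|)

theorem ratio_le_one (t : ℝ) : |t| / (1 + |t|) ≤ 1 := by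
  rw [div_le_one (by positivity)]; linarith [abs_nonneg t]

theorem bddAbove_ratio (i : Stage 𝓢) (f g : C(i.carrier, ℝ)) :
    BddAbove (Set.range fun x : i.carrier => |f x - g x| / (1 + |f x - g x|)) :=
  ⟨1, by rintro _ ⟨x, rfl⟩; exact ratio_le_one _⟩

theorem le_stageDist (i : Stage 𝓢) (f g : C(i.carrier, ℝ)) (x : i.carrier) :
    |f x - g x| / (1 + |f x - g x|) ≤ stageDist i f g :=
  le_ciSup (bddAbove_ratio i f g) x

theorem stageDist_nonneg (i : Stage 𝓢) (f g : C(i.carrier, ℝ)) : 0 ≤ stageDist i f g :=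
  Real.iSup_nonneg fun _ => by positivity

theorem stageDist_le (i : Stage 𝓢) (f g : C(i.carrier, ℝ)) {c : ℝ} (hc : 0 ≤ c)
    (h : ∀ x, |f x - g x| / (1 + |f x - g x|) ≤ c) : stageDist i f g ≤ c :=
  Real.iSup_le h hc

theorem stageDist_res (i j : Stage 𝓢) (h : i ≤ j) (f g : C(i.carrier, ℝ)) :
    stageDist i f g = stageDist j (res i j h f) (res i j h g) := by
  apply le_antisymm
  · refine stageDist_le _ _ _ (stageDist_nonneg _ _ _) fun x => ?_
    refine (denseRange_inclusion h).induction_on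
      (p := fun x => |f x - g x| / (1 + |f x - g x|) ≤
        stageDist j (res i j h f) (res i j h g)) x ?_ fun a =>
          le_stageDist j (res i j h f) (res i j h g) a
    refine isClosed_le (Continuous.div (by fun_prop) (by fun_prop) fun x => ?_) continuous_const
    positivity
  · exact stageDist_le _ _ _ (stageDist_nonneg _ _ _) fun x =>
      le_stageDist i f g (Set.inclusion h x)

instance : Dist (LimitRing 𝓢) where
  dist := DirectLimit.lift₂ res res stageDist stageDist_res

theorem dist_mk (i : Stage 𝓢) (f g : C(i.carrier, ℝ)) :
    dist (mk i f) (mk i g) = stageDist i f g := DirectLimit.lift₂_def ..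

theorem ratio_triangle (a b c : ℝ) :
    |a - c| / (1 + |a - c|) ≤ |a - b| / (1 + |a - b|) + |b - c| / (1 + |b - c|) := by
  have h := abs_sub_le a b c
  have h0 := abs_nonneg (a - c)
  have h1 := abs_nonneg (a - b)
  have h2 := abs_nonneg (b - c)
  generalize |a - c| = r at *
  generalize |a - b| = s at *
  generalize |b - c| = t at *
  rw [div_add_div _ _ (by positivity) (by positivity), div_le_div_iff₀ (by positivity)
    (by positivity)]
  nlinarith [mul_nonneg h1 h2, mul_nonneg h0 (mul_nonneg h1 h2)]

instance : MetricSpace (LimitRing 𝓢) where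
  dist_self := ind fun i f => by
    rw [dist_mk]
    exact le_antisymm (stageDist_le _ _ _ le_rfl fun x => by simp) (stageDist_nonneg _ _ _)
  dist_comm := ind₂ fun i f g => by simp only [dist_mk, stageDist, abs_sub_comm]
  dist_triangle := ind₃ fun i f g k => by
    simp only [dist_mk]
    refine stageDist_le _ _ _ (add_nonneg (stageDist_nonneg _ _ _) (stageDist_nonneg _ _ _))
      fun x => (ratio_triangle _ (g x) _).trans ?_
    exact add_le_add (le_stageDist _ _ _ x) (le_stageDist _ _ _ x)
  eq_of_dist_eq_zero := fun {a b} h => by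
    induction a, b using ind₂ with | h i f g => ?_
    refine congrArg _ (ContinuousMap.ext fun x => ?_)
    rw [dist_mk] at h
    have h1 := (le_stageDist i f g x).trans h.le
    have h2 : |f x - g x| / (1 + |f x - g x|) = 0 := le_antisymm h1 (by positivity)
    rcases div_eq_zero_iff.1 h2 with h3 | h3
    · exact sub_eq_zero.1 (abs_eq_zero.1 h3)
    · linarith [abs_nonneg (f x - g x)]

/-- A continuous function on the whole space, as an element of `C[𝓢]`. -/
def ofContinuous : C(Y, ℝ) →+* LimitRing 𝓢 where
  toFun f := mk ⟨Set.univ, 𝓢.univ_mem⟩ (f.comp ⟨Subtype.val, continuous_subtype_val⟩)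
  map_one' := mk_one _
  map_mul' f g := by rw [mk_mul]; rfl
  map_zero' := mk_zero _
  map_add' f g := by rw [mk_add]; rfl

/-- The map `C(S) → C[𝓣]`, `f ↦ f ∘ ι`, for a single member `S` of `𝓢`. -/
def pullbackStage {X : Type u} [TopologicalSpace X] {𝓣 : DenseFilterBase X} (ι : X → Y)
    (hc : Continuous ι) (h : ∀ S ∈ 𝓢.sets, ι ⁻¹' S ∈ 𝓣.sets) (i : Stage 𝓢) :
    C(i.carrier, ℝ) →+* LimitRing 𝓣 where
  toFun f := mk ⟨ι ⁻¹' i.carrier, h _ i.mem⟩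
    (f.comp ⟨i.carrier.restrictPreimage ι, hc.restrictPreimage⟩)
  map_one' := mk_one _
  map_zero' := mk_zero _
  map_mul' f g := by rw [mk_mul]; rfl
  map_add' f g := by rw [mk_add]; rfl

/-- For a continuous map `ι : X → Y` such that preimages of members of `𝓢` are members of `𝓣`,
the ring homomorphism `C[𝓢] → C[𝓣]`, `f ↦ f ∘ ι`. -/
def pullback {X : Type u} [TopologicalSpace X] {𝓣 : DenseFilterBase X} (ι : X → Y)
    (hc : Continuous ι) (h : ∀ S ∈ 𝓢.sets, ι ⁻¹' S ∈ 𝓣.sets) : LimitRing 𝓢 →+* LimitRing 𝓣 where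
  toFun := DirectLimit.lift res (fun i f => pullbackStage ι hc h i f) fun i j hij f =>
    (mk_res (i := ⟨ι ⁻¹' i.carrier, h _ i.mem⟩) (j := ⟨ι ⁻¹' j.carrier, h _ j.mem⟩)
      (Set.preimage_mono hij) (f.comp ⟨i.carrier.restrictPreimage ι, hc.restrictPreimage⟩)).symm
  map_one' := by
    rw [← mk_one ⟨Set.univ, 𝓢.univ_mem⟩]; exact map_one (pullbackStage ι hc h _)
  map_zero' := by
    rw [← mk_zero ⟨Set.univ, 𝓢.univ_mem⟩]; exact map_zero (pullbackStage ι hc h _)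
  map_mul' := ind₂ fun i f g => by
    rw [mk_mul]; exact map_mul (pullbackStage ι hc h i) f g
  map_add' := ind₂ fun i f g => by
    rw [mk_add]; exact map_add (pullbackStage ι hc h i) f g

theorem pullback_mk {X : Type u} [TopologicalSpace X] {𝓣 : DenseFilterBase X} (ι : X → Y)
    (hc : Continuous ι) (h : ∀ S ∈ 𝓢.sets, ι ⁻¹' S ∈ 𝓣.sets) (i : Stage 𝓢)
    (f : C(i.carrier, ℝ)) :
    pullback ι hc h (mk i f) = mk ⟨ι ⁻¹' i.carrier, h _ i.mem⟩
      (f.comp ⟨i.carrier.restrictPreimage ι, hc.restrictPreimage⟩) := rfl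

theorem monotone_pullback {X : Type u} [TopologicalSpace X] {𝓣 : DenseFilterBase X} (ι : X → Y)
    (hc : Continuous ι) (h : ∀ S ∈ 𝓢.sets, ι ⁻¹' S ∈ 𝓣.sets) :
    Monotone (pullback (𝓣 := 𝓣) ι hc h) := by
  intro a b
  revert a b
  refine ind₂ fun i f g hab => ?_
  rw [pullback_mk, pullback_mk, mk_le_mk]
  exact fun x => mk_le_mk.1 hab _

theorem monotone_ofContinuous : Monotone (ofContinuous (𝓢 := 𝓢)) := fun _ _ h =>
  mk_le_mk.2 fun x => h x

/-- The elements of `C[𝓢]` that have a representative in a given family of subrings of the rings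
`C(S)`, closed under restriction. -/
def subringOf (P : ∀ i : Stage 𝓢, Subring C(i.carrier, ℝ))
    (hP : ∀ i j h, ∀ f ∈ P i, res i j h f ∈ P j) : Subring (LimitRing 𝓢) where
  carrier := {a | ∃ i, ∃ f ∈ P i, a = mk i f}
  one_mem' := ⟨⟨Set.univ, 𝓢.univ_mem⟩, 1, one_mem _, (mk_one _).symm⟩
  zero_mem' := ⟨⟨Set.univ, 𝓢.univ_mem⟩, 0, zero_mem _, (mk_zero _).symm⟩
  mul_mem' := by
    rintro _ _ ⟨i, f, hf, rfl⟩ ⟨j, g, hg, rfl⟩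
    obtain ⟨k, hi, hj⟩ := exists_ge_ge i j
    exact ⟨k, _, mul_mem (hP i k hi f hf) (hP j k hj g hg), by rw [← mk_mul, mk_res, mk_res]⟩
  add_mem' := by
    rintro _ _ ⟨i, f, hf, rfl⟩ ⟨j, g, hg, rfl⟩
    obtain ⟨k, hi, hj⟩ := exists_ge_ge i j
    exact ⟨k, _, add_mem (hP i k hi f hf) (hP j k hj g hg), by rw [← mk_add, mk_res, mk_res]⟩
  neg_mem' := by
    rintro _ ⟨i, f, hf, rfl⟩
    exact ⟨i, _, neg_mem hf, by rw [mk_neg]⟩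

end LimitRing

end

/-! ### Bounded elements -/

theorem mul_mem_bounds {A : Type u} [CommRing A] [PartialOrder A] [IsOrderedRing A]
    {a b u v : A} (ha : -u ≤ a) (ha' : a ≤ u) (hb : -v ≤ b) (hb' : b ≤ v)
    (hu : 0 ≤ u) (hv : 0 ≤ v) : -(3 * (u * v)) ≤ a * b ∧ a * b ≤ 3 * (u * v) := by
  have a1 : 0 ≤ u + a := by simpa [add_comm] using sub_nonneg.2 ha
  have a2 : 0 ≤ u - a := sub_nonneg.2 ha'
  have b1 : 0 ≤ v + b := by simpa [add_comm] using sub_nonneg.2 hb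
  have b2 : 0 ≤ v - b := sub_nonneg.2 hb'
  constructor <;> rw [← sub_nonneg]
  · have : a * b - -(3 * (u * v)) =
        (u + a) * (v + b) + (u * (v - b) + v * (u - a)) := by ring
    rw [this]; positivity
  · have : 3 * (u * v) - a * b =
        (u + a) * (v - b) + (u * (v + b) + v * (u - a)) := by ring
    rw [this]; positivity

/-- The subring of bounded elements of a partially ordered ring: those `a` with `-m ≤ a ≤ m` for
some natural number `m`. In `C(X)` and in `C[𝓢]` these are the bounded functions. -/
def boundedElements (A : Type u) [CommRing A] [PartialOrder A] [IsOrderedRing A] : Subring A where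
  carrier := {a | ∃ m : ℕ, -(m : A) ≤ a ∧ a ≤ m}
  one_mem' := ⟨1, by
    have : (0 : A) ≤ 1 := zero_le_one
    constructor
    · rw [Nat.cast_one]; exact (neg_nonpos.2 this).trans this
    · simp⟩
  zero_mem' := ⟨0, by simp⟩
  add_mem' := by
    rintro a b ⟨m, ha, ha'⟩ ⟨n, hb, hb'⟩
    refine ⟨m + n, ?_, ?_⟩
    · rw [Nat.cast_add, neg_add]; exact add_le_add ha hb
    · rw [Nat.cast_add]; exact add_le_add ha' hb'
  neg_mem' := by
    rintro a ⟨m, ha, ha'⟩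
    exact ⟨m, neg_le_neg ha', neg_le.1 ha⟩
  mul_mem' := by
    rintro a b ⟨m, ha, ha'⟩ ⟨n, hb, hb'⟩
    refine ⟨3 * (m * n), ?_⟩
    push_cast
    exact mul_mem_bounds ha ha' hb hb' (Nat.cast_nonneg m) (Nat.cast_nonneg n)

theorem map_boundedElements {A B : Type u} [CommRing A] [PartialOrder A] [IsOrderedRing A]
    [CommRing B] [PartialOrder B] [IsOrderedRing B] (φ : A →+* B) (hφ : Monotone φ) :
    ∀ a ∈ boundedElements A, φ a ∈ boundedElements B := by
  rintro a ⟨m, h, h'⟩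
  exact ⟨m, by simpa using hφ h, by simpa using hφ h'⟩

/-! ### The rings `Q(X)` and `Q̄(X)` -/

section

variable (X : Type u) [TopologicalSpace X]

/-- `Q(X)`: continuous functions on dense open subsets of `X`, modulo agreement on the
intersection of the domains. -/
abbrev Q : Type u := LimitRing (denseOpen X)

/-- `Q̄(X)`: continuous functions on dense `G_δ` subsets of the Stone–Čech compactification `βX`,
modulo agreement on the intersection of the domains. -/
abbrev Qbar : Type u := LimitRing (denseGdelta (StoneCech X))

variable {X}

theorem preimage_mem_denseOpen [CompletelyRegularSpace X] :
    ∀ S ∈ (denseOpen (StoneCech X)).sets,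
      (stoneCechUnit : X → StoneCech X) ⁻¹' S ∈ (denseOpen X).sets := fun _ hS =>
  ⟨hS.1.preimage continuous_stoneCechUnit, by
    refine dense_iff_inter_open.2 fun U hU ⟨x, hx⟩ => ?_
    obtain ⟨O, hO, rfl⟩ := isInducing_stoneCechUnit.isOpen_iff.1 hU
    have hne : (O ∩ _).Nonempty := hS.2.inter_open_nonempty O hO ⟨_, hx⟩
    obtain ⟨y, hy⟩ := denseRange_stoneCechUnit.exists_mem_open (hO.inter hS.1) hne
    exact ⟨y, hy⟩⟩

variable (X)

/-- The restriction homomorphism `Q(βX) → Q(X)`, taking a continuous function on a dense open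
subset `W` of `βX` to its restriction to `W ∩ X`. -/
def restrictQ [T35Space X] : Q (StoneCech X) →+* Q X :=
  LimitRing.pullback stoneCechUnit continuous_stoneCechUnit preimage_mem_denseOpen

/-- The inclusion `Q(βX) → Q̄(X)`: a dense open subset of `βX` is a dense `G_δ`. -/
def inclQ : Q (StoneCech X) →+* Qbar X :=
  LimitRing.pullback id continuous_id fun _ hS => ⟨hS.1.isGδ, hS.2⟩

variable {X}

theorem exists_stoneCech_extension (f : X → ℝ) (hf : Continuous f) (M : ℝ) (hM : ∀ x, |f x| ≤ M) :
    ∃ F : C(StoneCech X, ℝ), ∀ x, F (stoneCechUnit x) = f x := by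
  let g : X → Set.Icc (-M) M := fun x => ⟨f x, abs_le.1 (hM x)⟩
  have hg : Continuous g := hf.subtype_mk _
  refine ⟨⟨fun y => (stoneCechExtend hg y).1,
    continuous_subtype_val.comp (continuous_stoneCechExtend hg)⟩, fun x => ?_⟩
  exact congrArg Subtype.val (stoneCechExtend_stoneCechUnit hg x)

/-- A continuous function on an open subset of `X` agrees, near each point of its domain, with
the restriction of a continuous function on `βX`. -/
theorem exists_local_extension [T35Space X] {V : Set X} (hV : IsOpen V) (f : C(V, ℝ)) (x : V) :
    ∃ O : Set (StoneCech X), IsOpen O ∧ stoneCechUnit x.1 ∈ O ∧ ∃ h : C(StoneCech X, ℝ),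
      ∀ z : V, stoneCechUnit z.1 ∈ O → h (stoneCechUnit z.1) = f z := by
  classical
  obtain ⟨e, he, hex, heV⟩ :=
    CompletelyRegularSpace.completely_regular_isOpen x.1 V hV x.2
  -- a cut-off function, equal to one near the given point and vanishing outside the open set
  let d : X → ℝ := fun z => min 1 (2 * (1 - (e z : ℝ)))
  have hd : Continuous d := by
    have : Continuous fun z => (e z : ℝ) := continuous_subtype_val.comp he
    fun_prop
  have hd0 : ∀ z, 0 ≤ d z := fun z => le_min zero_le_one (by linarith [(e z).2.2])
  have hd1 : ∀ z, d z ≤ 1 := fun z => min_le_left _ _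
  have hdV : ∀ z, z ∉ V → d z = 0 := fun z hz => by
    have : (e z : ℝ) = 1 := by rw [heV hz]; rfl
    simp [d, this]
  let p : V → ℝ := fun z => max (f x - 1) (min (f x + 1) (f z))
  have hp : Continuous p := by fun_prop
  have hpM : ∀ z, |p z| ≤ |f x| + 1 := fun z => by
    have h1 : f x - 1 ≤ p z := le_max_left _ _
    have h2 : p z ≤ f x + 1 := max_le (by linarith) (min_le_left _ _)
    exact abs_le.2 ⟨by linarith [neg_abs_le (f x)], by linarith [le_abs_self (f x)]⟩
  let k : X → ℝ := fun z => if hz : z ∈ V then d z * p ⟨z, hz⟩ else 0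
  have hkd : ∀ z, |k z| ≤ d z * (|f x| + 1) := fun z => by
    by_cases hz : z ∈ V
    · simp only [k, hz, dite_true, abs_mul, abs_of_nonneg (hd0 z)]
      exact mul_le_mul_of_nonneg_left (hpM _) (hd0 z)
    · simp [k, hz, hdV z hz]
  have hk : Continuous k := by
    rw [continuous_iff_continuousAt]
    intro z
    by_cases hz : z ∈ V
    · have : ContinuousOn k V := by
        rw [continuousOn_iff_continuous_domRestrict]
        have : V.domRestrict k = fun w : V => d w * p w := by
          funext w; simp [k, Set.domRestrict]
        rw [this]
        exact (hd.comp continuous_subtype_val).mul hp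
      exact this.continuousAt (hV.mem_nhds hz)
    · have hkz : k z = 0 := by simp [k, hz]
      rw [ContinuousAt, hkz]
      refine squeeze_zero_norm (fun w => hkd w) ?_
      have : Continuous fun w => d w * (|f x| + 1) := by fun_prop
      simpa [hdV z hz] using this.tendsto z
  obtain ⟨h, hh⟩ := exists_stoneCech_extension k hk (|f x| + 1) fun z =>
    (hkd z).trans (mul_le_of_le_one_left (by positivity) (hd1 z))
  have hNV : IsOpen {z : V | |f z - f x| < 1 ∧ (e z : ℝ) < 1 / 2} := by
    have : Continuous fun z : V => (e z : ℝ) :=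
      continuous_subtype_val.comp (he.comp continuous_subtype_val)
    exact (isOpen_lt (f := fun z : V => |f z - f x|) (by fun_prop) continuous_const).inter (isOpen_lt this continuous_const)
  have hN := hV.isOpenMap_subtype_val _ hNV
  obtain ⟨O, hO, hON⟩ := isInducing_stoneCechUnit.isOpen_iff.1 hN
  refine ⟨O, hO, ?_, h, fun z hz => ?_⟩
  · change x.1 ∈ stoneCechUnit ⁻¹' O
    rw [hON]
    exact ⟨x, ⟨by simp, by rw [hex]; norm_num⟩, rfl⟩
  · have hz' : z.1 ∈ stoneCechUnit ⁻¹' O := hz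
    rw [hON] at hz'
    obtain ⟨w, ⟨hw1, hw2⟩, hwz⟩ := hz'
    obtain rfl : w = z := Subtype.ext hwz
    rw [hh]
    have hd' : d w = 1 := min_eq_left (by linarith)
    have hp' : p w = f w := by
      rw [abs_lt] at hw1
      simp only [p]
      rw [min_eq_right (by linarith), max_eq_right (by linarith)]
    simp [k, hd', hp']

theorem restrictQ_le_iff [T35Space X] {a b : Q (StoneCech X)} :
    restrictQ X a ≤ restrictQ X b ↔ a ≤ b := by
  refine ⟨?_, fun h => LimitRing.monotone_pullback _ _ _ h⟩
  induction a, b using LimitRing.ind₂ with | h i f g => ?_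
  intro hab
  have hab' := LimitRing.mk_le_mk.1 hab
  rw [LimitRing.mk_le_mk]
  intro y
  have hcl : IsClosed {y | f y ≤ g y} := isClosed_le f.continuous g.continuous
  have hdr : Dense {y : i.carrier | ∃ x : X, stoneCechUnit x = y.1} := by
    rw [Subtype.dense_iff]
    intro y hy
    rw [mem_closure_iff]
    intro O hO hyO
    obtain ⟨x, hx⟩ := denseRange_stoneCechUnit.exists_mem_open (hO.inter i.mem.1) ⟨y, hyO, hy⟩
    exact ⟨_, hx.1, ⟨⟨_, hx.2⟩, ⟨x, rfl⟩, rfl⟩⟩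
  have hsub : closure {y : i.carrier | ∃ x : X, stoneCechUnit x = y.1} ⊆ {y | f y ≤ g y} := by
    refine closure_minimal ?_ hcl
    rintro ⟨_, hy⟩ ⟨x, rfl⟩
    exact hab' ⟨x, hy⟩
  exact hsub (hdr y)

/-- Every continuous function on a dense open subset of `X` extends uniquely to a dense open
subset of `βX`: restriction identifies `Q(βX)` with `Q(X)`. -/
theorem restrictQ_bijective [T35Space X] : Function.Bijective (restrictQ X) := by
  constructor
  · intro a b hab
    exact le_antisymm (restrictQ_le_iff.1 hab.le) (restrictQ_le_iff.1 hab.ge)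
  · intro a
    induction a using LimitRing.ind with | h i f => ?_
    obtain ⟨V, hVo, hVd⟩ := i
    dsimp only at f
    -- pairs consisting of an open set of the compactification and a function extending `f` there
    let good : Set (StoneCech X) → C(StoneCech X, ℝ) → Prop := fun O h =>
      IsOpen O ∧ ∀ z : V, stoneCechUnit z.1 ∈ O → h (stoneCechUnit z.1) = f z
    let W : Set (StoneCech X) := {y | ∃ O h, good O h ∧ y ∈ O}
    have hWo : IsOpen W := by
      rw [isOpen_iff_forall_mem_open]
      rintro y ⟨O, h, hg, hy⟩
      exact ⟨O, fun z hz => ⟨O, h, hg, hz⟩, hg.1, hy⟩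
    have hVW : ∀ z : V, stoneCechUnit z.1 ∈ W := fun z => by
      obtain ⟨O, hO, hz, h, hh⟩ := exists_local_extension hVo f z
      exact ⟨O, h, ⟨hO, hh⟩, hz⟩
    have hVdense : Dense (stoneCechUnit '' V : Set (StoneCech X)) :=
      denseRange_stoneCechUnit.dense_image continuous_stoneCechUnit hVd
    have hWd : Dense W := hVdense.mono (by rintro _ ⟨z, hz, rfl⟩; exact hVW ⟨z, hz⟩)
    have huniq : ∀ O h O' h', good O h → good O' h' → ∀ y ∈ O ∩ O', h y = h' y := by
      intro O h O' h' hg hg' y hy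
      by_contra hne
      have hopen : IsOpen ((O ∩ O') ∩ {y | h y ≠ h' y}) :=
        (hg.1.inter hg'.1).inter (isOpen_ne_fun h.continuous h'.continuous)
      obtain ⟨_, hz1, z, hz, rfl⟩ := hVdense.inter_open_nonempty _ hopen ⟨y, hy, hne⟩
      exact hz1.2 ((hg.2 ⟨z, hz⟩ hz1.1.1).trans (hg'.2 ⟨z, hz⟩ hz1.1.2).symm)
    choose! O h hgood hmem using fun (y : StoneCech X) (hy : y ∈ W) => hy
    have hGc : Continuous fun y : W => h y.1 y.1 := by
      rw [continuous_iff_continuousAt]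
      intro y
      have : (fun w : W => h w.1 w.1) =ᶠ[nhds y] fun w : W => h y.1 w.1 := by
        filter_upwards [((hgood y.1 y.2).1.preimage continuous_subtype_val).mem_nhds (hmem y.1 y.2)]
          with w hw
        exact huniq _ _ _ _ (hgood w.1 w.2) (hgood y.1 y.2) w.1 ⟨hmem w.1 w.2, hw⟩
      exact ContinuousAt.congr ((h y.1).continuous.comp continuous_subtype_val).continuousAt
        this.symm
    refine ⟨LimitRing.mk ⟨W, hWo, hWd⟩ ⟨_, hGc⟩, ?_⟩
    rw [restrictQ, LimitRing.pullback_mk]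
    let i' : Stage (denseOpen X) := ⟨V, hVo, hVd⟩
    let j' : Stage (denseOpen X) :=
      ⟨stoneCechUnit ⁻¹' W, preimage_mem_denseOpen _ ⟨hWo, hWd⟩⟩
    have hji : j' ≤ i' := fun z hz => hVW ⟨z, hz⟩
    rw [← LimitRing.mk_res hji]
    refine congrArg _ (ContinuousMap.ext fun z => ?_)
    exact (hgood _ (hVW z)).2 z (hmem _ (hVW z))

variable (X)

/-- The embedding `Q(X) = Q(βX) ⊂ Q̄(X)`. -/
def toQbar [T35Space X] : Q X →+* Qbar X :=
  (inclQ X).comp (RingEquiv.ofBijective (restrictQ X) restrictQ_bijective).symm.toRingHom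

variable {X}

theorem monotone_toQbar [T35Space X] : Monotone (toQbar X) := by
  intro a b h
  refine LimitRing.monotone_pullback _ _ _ ?_
  rw [← restrictQ_le_iff]
  have key (c : Q X) : restrictQ X ((RingEquiv.ofBijective (restrictQ X)
      restrictQ_bijective).symm c) = c :=
    (RingEquiv.ofBijective (restrictQ X) restrictQ_bijective).apply_symm_apply c
  exact (key a).le.trans (h.trans (key b).ge)

variable (X)

/-- The embedding `C(X) ⊂ Q(X) ⊂ Q̄(X)`. -/
def continuousToQbar [T35Space X] : C(X, ℝ) →+* Qbar X :=
  (toQbar X).comp LimitRing.ofContinuous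

/-- `Q_L(X)`: elements of `Q(X)` represented by a locally constant function on a dense open set. -/
def QL : Subring (Q X) :=
  LimitRing.subringOf
    (fun _ =>
      { carrier := {f | IsLocallyConstant f}
        one_mem' := IsLocallyConstant.const 1
        zero_mem' := IsLocallyConstant.const 0
        mul_mem' := fun hf hg => IsLocallyConstant.mul hf hg
        add_mem' := fun hf hg => IsLocallyConstant.add hf hg
        neg_mem' := fun hf => IsLocallyConstant.neg hf })
    fun i _ h f (hf : IsLocallyConstant f) =>
      (hf.comp_continuous (continuous_inclusion h) :)

/-- `Q_F(X)`: elements of `Q(X)` represented by a continuous function with finite range on a dense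
open set. -/
def QF : Subring (Q X) :=
  LimitRing.subringOf
    (fun i =>
      { carrier := {f | (Set.range f).Finite}
        one_mem' := (Set.finite_singleton (1 : ℝ)).subset (by rintro _ ⟨x, rfl⟩; rfl)
        zero_mem' := (Set.finite_singleton (0 : ℝ)).subset (by rintro _ ⟨x, rfl⟩; rfl)
        mul_mem' := fun hf hg => (Set.Finite.image2 (· * ·) hf hg).subset (by
          rintro _ ⟨x, rfl⟩; exact ⟨_, ⟨x, rfl⟩, _, ⟨x, rfl⟩, rfl⟩)
        add_mem' := fun hf hg => (Set.Finite.image2 (· + ·) hf hg).subset (by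
          rintro _ ⟨x, rfl⟩; exact ⟨_, ⟨x, rfl⟩, _, ⟨x, rfl⟩, rfl⟩)
        neg_mem' := fun hf => (Set.Finite.image (- ·) hf).subset (by
          rintro _ ⟨x, rfl⟩; exact ⟨_, ⟨x, rfl⟩, rfl⟩) })
    fun i j h f hf => Set.Finite.subset hf (by rintro _ ⟨x, rfl⟩; exact ⟨_, rfl⟩)

/-- `Q*(X)`: the bounded elements of `Q(X)`. -/
abbrev Qstar : Subring (Q X) := boundedElements (Q X)

/-- `Q̄*(X)`: the bounded elements of `Q̄(X)`. -/
abbrev QbarStar : Subring (Qbar X) := boundedElements (Qbar X)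

/-- `C*(X)`: the bounded elements of `C(X)`. -/
abbrev CStar : Subring C(X, ℝ) := boundedElements C(X, ℝ)

/-- The ring of `C`-bounded elements of `Q̄(X)`: those `h` with `|h| ≤ g` for some `g` in `C(X)`. -/
def CBounded [T35Space X] : Subring (Qbar X) where
  carrier := {h | ∃ g : C(X, ℝ), |h| ≤ continuousToQbar X g}
  one_mem' := ⟨1, by
    rw [map_one]; exact abs_le'.2 ⟨le_rfl, (neg_nonpos.2 zero_le_one).trans zero_le_one⟩⟩
  zero_mem' := ⟨0, by rw [map_zero]; exact abs_le'.2 ⟨le_rfl, by simp⟩⟩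
  add_mem' := by
    rintro a b ⟨g, ha⟩ ⟨k, hb⟩
    refine ⟨g + k, ?_⟩
    rw [abs_le'] at ha hb ⊢
    rw [map_add, neg_add]
    exact ⟨add_le_add ha.1 hb.1, add_le_add ha.2 hb.2⟩
  neg_mem' := by
    rintro a ⟨g, ha⟩
    exact ⟨g, by rwa [abs_neg]⟩
  mul_mem' := by
    rintro a b ⟨g, ha⟩ ⟨k, hb⟩
    refine ⟨3 * (g * k), ?_⟩
    have hg := (abs_nonneg a).trans ha
    have hk := (abs_nonneg b).trans hb
    rw [abs_le'] at ha hb ⊢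
    have h := mul_mem_bounds (neg_le.1 ha.2) ha.1 (neg_le.1 hb.2) hb.1 hg hk
    rw [map_mul, map_mul, map_ofNat]
    exact ⟨h.2, neg_le.1 h.1⟩

variable {X}

theorem monotone_continuousToQbar [T35Space X] : Monotone (continuousToQbar X) :=
  fun _ _ h => monotone_toQbar (LimitRing.monotone_ofContinuous h)

theorem QF_le_Qstar : QF X ≤ Qstar X := by
  rintro _ ⟨i, f, hf, rfl⟩
  obtain ⟨M, hM⟩ := hf.bddAbove
  obtain ⟨N, hN⟩ := hf.bddBelow
  obtain ⟨m, hm⟩ := exists_nat_ge (max M (-N))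
  rw [max_le_iff] at hm
  refine ⟨m, ?_, ?_⟩
  · rw [← LimitRing.mk_natCast i, LimitRing.mk_neg, LimitRing.mk_le_mk]
    intro x
    have := hN ⟨x, rfl⟩
    have h2 : (-(m : C(i.carrier, ℝ))) x = -(m : ℝ) := by simp
    change (-(m : C(i.carrier, ℝ))) x ≤ f x
    rw [h2]; linarith [hm.2]
  · rw [← LimitRing.mk_natCast i, LimitRing.mk_le_mk]
    intro x
    have := hM ⟨x, rfl⟩
    have h2 : (m : C(i.carrier, ℝ)) x = (m : ℝ) := by simp
    change f x ≤ (m : C(i.carrier, ℝ)) x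
    rw [h2]; linarith [hm.1]

theorem continuousToQbar_mem_CBounded [T35Space X] (f : C(X, ℝ)) :
    continuousToQbar X f ∈ CBounded X :=
  ⟨|f|, abs_le'.2 ⟨monotone_continuousToQbar (le_abs_self f), by
    rw [← map_neg]; exact monotone_continuousToQbar (neg_le_abs f)⟩⟩

variable (X)

/-- The embedding `Q_L(X) ⊂ Q̄(X)`. -/
def qlToQbar [T35Space X] : QL X →+* Qbar X := (toQbar X).comp (QL X).subtype

/-- The embedding `Q*(X) ⊂ Q̄*(X)`. -/
def qstarToQbarStar [T35Space X] : Qstar X →+* QbarStar X :=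
  (toQbar X).restrict (Qstar X) (QbarStar X) (map_boundedElements _ monotone_toQbar)

/-- The embedding `Q_F(X) ⊂ Q̄*(X)`. -/
def qfToQbarStar [T35Space X] : QF X →+* QbarStar X :=
  (qstarToQbarStar X).comp (Subring.inclusion QF_le_Qstar)

/-- The embedding of `C(X)` in the ring of `C`-bounded elements of `Q̄(X)`. -/
def continuousToCBounded [T35Space X] : C(X, ℝ) →+* CBounded X :=
  (continuousToQbar X).codRestrict (CBounded X) continuousToQbar_mem_CBounded

/-- The embedding `C*(X) ⊂ Q̄*(X)`. -/
def cstarToQbarStar [T35Space X] : CStar X →+* QbarStar X :=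
  (continuousToQbar X).restrict (CStar X) (QbarStar X)
    (map_boundedElements _ monotone_continuousToQbar)

end

/-! ### Completions -/

/-- `φ : A → B` exhibits `B` as the Dedekind completion of `A`: it is an embedding of ordered
rings, every nonempty subset of `B` with an upper bound has a supremum, and every element of `B`
is the supremum of a set of elements of `A`. -/
structure IsDedekindCompletion {A B : Type u} [CommRing A] [PartialOrder A] [CommRing B]
    [PartialOrder B] (φ : A →+* B) : Prop where
  le_iff : ∀ a a' : A, φ a ≤ φ a' ↔ a ≤ a'
  exists_isLUB : ∀ P : Set B, P.Nonempty → BddAbove P → ∃ s, IsLUB P s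
  isLUB_image : ∀ b : B, ∃ P : Set A, IsLUB (φ '' P) b

/-- `φ : A → B` exhibits `B` as the metric completion of `A`. -/
structure IsMetricCompletion {A B : Type u} [MetricSpace A] [MetricSpace B] (φ : A → B) :
    Prop where
  isometry : Isometry φ
  denseRange : DenseRange φ
  complete : CompleteSpace B

/-- `φ : A → B` exhibits `B` as a ring of quotients of its subring `A`: for all `b` and `b' ≠ 0` in
`B` there is `a` in `A` such that `b a ∈ A` and `b' a ≠ 0`. -/
structure IsRingOfQuotients {A B : Type u} [CommRing A] [CommRing B] (φ : A →+* B) : Prop where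
  injective : Function.Injective φ
  exists_mul : ∀ b b' : B, b' ≠ 0 → ∃ a : A, b * φ a ∈ φ.range ∧ b' * φ a ≠ 0

/-- `φ : A → B` exhibits `B` as the maximal (largest) ring of quotients of `A`. -/
structure IsMaximalRingOfQuotients {A B : Type u} [CommRing A] [CommRing B] (φ : A →+* B) :
    Prop where
  isRingOfQuotients : IsRingOfQuotients φ
  exists_embedding : ∀ (B' : Type u) [CommRing B'] (ψ : A →+* B'), IsRingOfQuotients ψ →
    ∃ θ : B' →+* B, Function.Injective θ ∧ θ.comp ψ = φ

end

end RingsOfFunctions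

/-!
A `C(X)`-linear map `f : I → C(X)` on an ideal with zero annihilator is multiplication by a function
on the dense open set where some `a ∈ I` does not vanish, namely by `f(a) / a` there; this is what
makes `Q(X)` the largest ring of quotients.

A bounded family in `C[𝓢]` has its supremum represented by the function `y ↦ sup {q | y ∈ U q}`,
where `U q` is the union of the open sets on which some member of the family exceeds `q`. This
function is continuous off the frontiers of the `U q` with `q` rational. These are countably many
closed nowhere dense sets, so by Baire's theorem the function lives on a dense `G_δ`.

An element `b` is the supremum of the elements of a subring below it as soon as the subring contains
some `g ≤ b` and cut-off functions for all open sets: if `v < r < b` on an open set, then for a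
cut-off function `e` of that set `(1 - e) g + e r` is below `b` but not below `v`.

The metric is determined by the order and the constants, since `d(a, b) ≤ δ / (1 + δ)` means
`|a - b| ≤ δ`; hence `Q(X) ⊂ Q̄(X)` is isometric. It is dense because a continuous function is
within `ε` of a constant on each member of a maximal disjoint family of small open sets, and `Q̄(X)`
is complete because a uniform limit exists on the intersection of countably many dense `G_δ` sets.
-/

namespace RingsOfFunctions

universe u

noncomputable section

/-! ### Rings of quotients -/

section

variable {A B B' : Type u} [CommRing B'] [CommRing A] [CommRing B]

/-- The ideal of those `a` in `A` that clear the denominator of `b`, i.e. with `b a ∈ A`, for a ring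
`B` over `A`. -/
def denominators (ψ : A →+* B) (b : B) : Ideal A where
  carrier := {a | b * ψ a ∈ ψ.range}
  zero_mem' := ⟨0, by simp⟩
  add_mem' := by
    rintro a a' ⟨c, hc⟩ ⟨c', hc'⟩
    exact ⟨c + c', by rw [map_add, map_add, hc, hc', mul_add]⟩
  smul_mem' := by
    rintro r a ⟨c, hc⟩
    exact ⟨r * c, by rw [smul_eq_mul, map_mul, map_mul, hc, mul_left_comm]⟩

/-- `b` and `q`, in two rings over `A`, are compatible as fractions: whenever `b = c / a`, in the
sense that `b a = c` with `a` and `c` in `A`, also `q = c / a`. -/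
def SameFractions (ψ : A →+* B') (φ : A →+* B) (b : B') (q : B) : Prop :=
  ∀ ⦃a c : A⦄, b * ψ a = ψ c → q * φ a = φ c

namespace IsRingOfQuotients

variable {ψ : A →+* B'} {φ : A →+* B}

theorem annihilator_denominators (hψ : IsRingOfQuotients ψ) (b : B') :
    (denominators ψ b).annihilator = ⊥ := by
  rw [eq_bot_iff]
  intro x hx
  by_contra hx0
  obtain ⟨a, ha, hxa⟩ := hψ.exists_mul b (ψ x) ((map_ne_zero_iff ψ hψ.injective).2 hx0)
  refine hxa ?_
  rw [← map_mul, ← smul_eq_mul, Submodule.mem_annihilator.1 hx a ha, map_zero]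

theorem exists_numerator (hψ : IsRingOfQuotients ψ) (b : B') :
    ∃ f : denominators ψ b →ₗ[A] A, ∀ a, ψ (f a) = b * ψ a := by
  choose f hf using fun a : denominators ψ b => a.2
  refine ⟨{ toFun := f, map_add' := fun a a' => hψ.injective ?_,
            map_smul' := fun r a => hψ.injective ?_ }, hf⟩
  · rw [map_add, hf, hf, hf, Submodule.coe_add, map_add, mul_add]
  · rw [RingHom.id_apply, smul_eq_mul, map_mul, hf, hf, Submodule.coe_smul, smul_eq_mul, map_mul,
      mul_left_comm]

theorem eq_of_forall_denominators (hψ : IsRingOfQuotients ψ) (hφ : IsRingOfQuotients φ) (b : B')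
    {q q' : B} (h : ∀ a c, b * ψ a = ψ c → q * φ a = q' * φ a) : q = q' := by
  by_contra hne
  obtain ⟨a, ⟨x, hx⟩, hxa⟩ := hφ.exists_mul (q - q') (q - q') (sub_ne_zero.2 hne)
  have hψx : ψ x ≠ 0 := by
    rw [map_ne_zero_iff ψ hψ.injective]
    rintro rfl
    exact hxa (by rw [← hx, map_zero])
  obtain ⟨d, ⟨c, hc⟩, hd⟩ := hψ.exists_mul b (ψ x) hψx
  have hqd : (q - q') * φ d = 0 := by rw [sub_mul, h d c hc.symm, sub_self]
  have hxd : φ (x * d) = 0 := by rw [map_mul, hx, mul_right_comm, hqd, zero_mul]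
  rw [map_eq_zero_iff φ hφ.injective] at hxd
  exact hd (by rw [← map_mul, hxd, map_zero])

end IsRingOfQuotients

namespace SameFractions

variable {ψ : A →+* B'} {φ : A →+* B}

theorem map (hψ : IsRingOfQuotients ψ) (a : A) : SameFractions ψ φ (ψ a) (φ a) := fun x c h => by
  rw [← map_mul] at h ⊢
  rw [hψ.injective h]

variable {b b' : B'} {q q' : B}

theorem unique (hψ : IsRingOfQuotients ψ) (hφ : IsRingOfQuotients φ)
    (h : SameFractions ψ φ b q) (h' : SameFractions ψ φ b q') : q = q' :=
  hψ.eq_of_forall_denominators hφ b fun _ _ hac => (h hac).trans (h' hac).symm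

theorem symm (hψ : IsRingOfQuotients ψ) (hφ : IsRingOfQuotients φ)
    (h : SameFractions ψ φ b q) : SameFractions φ ψ q b := fun a c hac => by
  refine hψ.eq_of_forall_denominators hψ b fun d e hde => ?_
  have hq : φ (a * e) = φ (c * d) := by
    rw [map_mul, map_mul, ← h hde, ← hac]; ring
  rw [mul_right_comm, hde, ← map_mul, ← map_mul, mul_comm e, hφ.injective hq]

theorem add (hψ : IsRingOfQuotients ψ) (hφ : IsRingOfQuotients φ)
    (h : SameFractions ψ φ b q) (h' : SameFractions ψ φ b' q') :
    SameFractions ψ φ (b + b') (q + q') := fun a c hac => by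
  refine hψ.eq_of_forall_denominators hφ b fun d e hde => ?_
  refine hψ.eq_of_forall_denominators hφ b' fun d' e' hde' => ?_
  have hcommon : c * d * d' = a * (e * d' + e' * d) := hψ.injective <| by
    simp only [map_mul, map_add, ← hac, ← hde, ← hde']; ring
  calc (q + q') * φ a * φ d * φ d' = φ (a * (e * d' + e' * d)) := by
        simp only [map_mul, map_add, ← h hde, ← h' hde']; ring
    _ = φ c * φ d * φ d' := by rw [← hcommon, map_mul, map_mul]

theorem mul (hψ : IsRingOfQuotients ψ) (hφ : IsRingOfQuotients φ)
    (h : SameFractions ψ φ b q) (h' : SameFractions ψ φ b' q') :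
    SameFractions ψ φ (b * b') (q * q') := fun a c hac => by
  refine hψ.eq_of_forall_denominators hφ b fun d e hde => ?_
  refine hψ.eq_of_forall_denominators hφ b' fun d' e' hde' => ?_
  have hcommon : c * d * d' = a * (e * e') := hψ.injective <| by
    simp only [map_mul, ← hac, ← hde, ← hde']; ring
  calc q * q' * φ a * φ d * φ d' = φ (a * (e * e')) := by
        simp only [map_mul, ← h hde, ← h' hde']; ring
    _ = φ c * φ d * φ d' := by rw [← hcommon, map_mul, map_mul]

theorem exists_embedding (hψ : IsRingOfQuotients ψ) (hφ : IsRingOfQuotients φ)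
    (h : ∀ b : B', ∃ q : B, SameFractions ψ φ b q) :
    ∃ θ : B' →+* B, Function.Injective θ ∧ θ.comp ψ = φ := by
  choose θ hθ using h
  have hmap : ∀ a, θ (ψ a) = φ a := fun a => unique hψ hφ (hθ _) (map hψ a)
  refine ⟨{ toFun := θ
            map_one' := by rw [← map_one ψ, hmap, map_one]
            map_zero' := by rw [← map_zero ψ, hmap, map_zero]
            map_add' := fun b b' => unique hψ hφ (hθ _) (add hψ hφ (hθ b) (hθ b'))
            map_mul' := fun b b' => unique hψ hφ (hθ _) (mul hψ hφ (hθ b) (hθ b')) },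
    fun b b' (hb : θ b = θ b') => ?_, RingHom.ext hmap⟩
  exact unique hφ hψ (symm hψ hφ (hθ b)) (symm hψ hφ (hb ▸ hθ b'))

end SameFractions

theorem IsRingOfQuotients.isMaximalRingOfQuotients {φ : A →+* B} (hφ : IsRingOfQuotients φ)
    (h : ∀ (I : Ideal A) (f : I →ₗ[A] A), I.annihilator = ⊥ → ∃ q : B, ∀ a : I, q * φ a = φ (f a)) :
    IsMaximalRingOfQuotients φ := by
  refine ⟨hφ, fun B' _ ψ hψ => SameFractions.exists_embedding hψ hφ fun b => ?_⟩
  obtain ⟨f, hf⟩ := hψ.exists_numerator b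
  obtain ⟨q, hq⟩ := h _ f (hψ.annihilator_denominators b)
  refine ⟨q, fun a c hac => ?_⟩
  have hfa : f ⟨a, c, hac.symm⟩ = c := hψ.injective ((hf _).trans hac)
  rw [hq ⟨a, c, hac.symm⟩, hfa]

end

/-! ### `Q(X)` as a ring of quotients of `C(X)` -/

section

variable {X : Type u} [TopologicalSpace X]

theorem exists_bump [CompletelyRegularSpace X] {O : Set X} (hO : IsOpen O) {x : X} (hx : x ∈ O) :
    ∃ e : C(X, ℝ), (∀ y, e y ∈ Set.Icc 0 1) ∧ tsupport e ⊆ O ∧ ∃ O' : Set X, IsOpen O' ∧ x ∈ O' ∧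
      Set.EqOn e 1 O' := by
  obtain ⟨d, hd, hdx, hdO⟩ := CompletelyRegularSpace.completely_regular_isOpen x O hO hx
  have hd' : Continuous fun y => (d y : ℝ) := continuous_subtype_val.comp hd
  refine ⟨⟨fun y => min 1 (max 0 (2 - 3 * (d y : ℝ))), by fun_prop⟩, fun y => ?_, ?_,
    {y | (d y : ℝ) < 1 / 3}, isOpen_lt hd' continuous_const, ?_, fun y hy => ?_⟩
  · exact ⟨le_min zero_le_one (le_max_left _ _), min_le_left _ _⟩
  · refine (closure_minimal (t := {y | (d y : ℝ) ≤ 2 / 3}) (fun y hy => ?_)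
      (isClosed_le hd' continuous_const)).trans fun y hy => ?_
    · by_contra hlt
      refine hy ?_
      have : 2 - 3 * (d y : ℝ) ≤ 0 := by rw [Set.mem_ofPred_eq] at hlt; linarith
      simp [max_eq_left this]
    · by_contra hyO
      have : (d y : ℝ) = 1 := congrArg Subtype.val (hdO hyO)
      rw [Set.mem_ofPred_eq, this] at hy
      norm_num at hy
  · simp [hdx]
  · rw [Set.mem_ofPred_eq] at hy
    exact min_eq_left (le_max_of_le_right (by linarith))

theorem exists_continuousMap_eq_mul {V : Set X} (hV : IsOpen V) (f : C(V, ℝ)) {e : C(X, ℝ)}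
    (he : tsupport e ⊆ V) : ∃ h : C(X, ℝ), ∀ z : V, h z = f z * e z := by
  let g : X → ℝ := Function.extend Subtype.val f 0
  have hg : ∀ z : V, g z = f z := Subtype.val_injective.extend_apply _ _
  have hgV : ContinuousOn g V := by
    rw [continuousOn_iff_continuous_domRestrict]
    exact f.continuous.congr fun z => (hg z).symm
  refine ⟨⟨fun y => g y * e y, ContinuousOn.continuous_of_tsupport_subset
    (hgV.mul e.continuous.continuousOn) hV ((tsupport_mul_subset_right).trans he)⟩, fun z => ?_⟩
  exact congrArg (· * e z) (hg z)

namespace LimitRing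

variable {𝓢 : DenseFilterBase X}

theorem ofContinuous_eq_mk (i : Stage 𝓢) (f : C(X, ℝ)) :
    ofContinuous f = mk i (f.restrict i.carrier) :=
  (mk_res (i := ⟨Set.univ, 𝓢.univ_mem⟩) (Set.subset_univ i.carrier) _).symm

theorem ofContinuous_le_ofContinuous {f g : C(X, ℝ)} :
    (ofContinuous f : LimitRing 𝓢) ≤ ofContinuous g ↔ f ≤ g :=
  mk_le_mk.trans ⟨fun h x => h ⟨x, trivial⟩, fun h x => h x⟩

theorem ofContinuous_injective : Function.Injective (ofContinuous (𝓢 := 𝓢)) := fun _ _ h =>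
  le_antisymm (ofContinuous_le_ofContinuous.1 h.le) (ofContinuous_le_ofContinuous.1 h.ge)

end LimitRing

open LimitRing

theorem isRingOfQuotients_ofContinuous [CompletelyRegularSpace X] :
    IsRingOfQuotients (ofContinuous : C(X, ℝ) →+* Q X) := by
  refine ⟨ofContinuous_injective, ind₂ fun i f f' hf' => ?_⟩
  obtain ⟨x, hx⟩ : ∃ x, f' x ≠ 0 := by
    by_contra! h
    exact hf' (by rw [show f' = 0 from ContinuousMap.ext h, mk_zero])
  obtain ⟨e, -, heV, O, -, hxO, he⟩ := exists_bump i.mem.1 x.2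
  obtain ⟨h, hh⟩ := exists_continuousMap_eq_mul i.mem.1 f heV
  refine ⟨e, ⟨h, ?_⟩, fun h0 => hx ?_⟩
  · rw [ofContinuous_eq_mk i, ofContinuous_eq_mk i, mk_mul]
    exact congrArg (mk i) (ContinuousMap.ext hh)
  · rw [ofContinuous_eq_mk i, mk_mul, ← mk_zero i] at h0
    have : f' x * e x = 0 := DFunLike.congr_fun (mk_injective i h0) x
    rwa [he hxO, Pi.one_apply, mul_one] at this

theorem dense_setOfIdeal [CompletelyRegularSpace X] {I : Ideal C(X, ℝ)} (hI : I.annihilator = ⊥) :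
    Dense (ContinuousMap.setOfIdeal I) := by
  rw [dense_iff_inter_open]
  rintro O hO ⟨x, hx⟩
  by_contra hempty
  obtain ⟨e, -, heO, O', -, hxO', he⟩ := exists_bump hO hx
  have hann : e ∈ I.annihilator := Submodule.mem_annihilator.2 fun a ha => ContinuousMap.ext
    fun y => by
      by_cases hy : y ∈ O
      · have hay : a y = 0 := by
          by_contra h
          exact hempty ⟨y, hy, ContinuousMap.mem_setOfIdeal.2 ⟨a, ha, h⟩⟩
        simp [hay]
      · simp [image_eq_zero_of_notMem_tsupport fun h => hy (heO h)]
  rw [hI, Submodule.mem_bot] at hann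
  have : e x = 1 := he hxO'
  simp [hann] at this

theorem exists_continuousMap_setOfIdeal_mul_eq (I : Ideal C(X, ℝ)) (f : I →ₗ[C(X, ℝ)] C(X, ℝ)) :
    ∃ F : C(ContinuousMap.setOfIdeal I, ℝ), ∀ (a : I) x, F x * (a : C(X, ℝ)) x = f a x := by
  have hmul : ∀ (a b : I) (x : X), f a x * (b : C(X, ℝ)) x = f b x * (a : C(X, ℝ)) x := by
    intro a b x
    have h : f ((b : C(X, ℝ)) • a) = f ((a : C(X, ℝ)) • b) :=
      congrArg f (Subtype.ext (mul_comm _ _))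
    rw [map_smul, map_smul] at h
    simpa [mul_comm] using DFunLike.congr_fun h x
  choose p hpI hp using fun x : ContinuousMap.setOfIdeal I => ContinuousMap.mem_setOfIdeal.1 x.2
  let F : ContinuousMap.setOfIdeal I → ℝ := fun x => f ⟨p x, hpI x⟩ x / p x x
  have hF : ∀ (a : I) x, F x * (a : C(X, ℝ)) x = f a x := fun a x => by
    rw [div_mul_eq_mul_div, hmul ⟨p x, hpI x⟩ a x, mul_div_cancel_right₀ _ (hp x)]
  refine ⟨⟨F, continuous_iff_continuousAt.2 fun x => ?_⟩, hF⟩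
  have hquot : ContinuousAt (fun y : ContinuousMap.setOfIdeal I => f ⟨p x, hpI x⟩ y / p x y) x :=
    ContinuousAt.div (by fun_prop) (by fun_prop) (hp x)
  have hne : ∀ᶠ y : ContinuousMap.setOfIdeal I in nhds x, p x y ≠ 0 :=
    ContinuousAt.eventually_ne (by fun_prop) (hp x)
  refine hquot.congr (hne.mono fun y hy => ?_)
  exact (eq_div_of_mul_eq hy (hF ⟨p x, hpI x⟩ y)).symm

theorem isMaximalRingOfQuotients_ofContinuous [CompletelyRegularSpace X] :
    IsMaximalRingOfQuotients (ofContinuous : C(X, ℝ) →+* Q X) := by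
  refine isRingOfQuotients_ofContinuous.isMaximalRingOfQuotients fun I f hI => ?_
  obtain ⟨F, hF⟩ := exists_continuousMap_setOfIdeal_mul_eq I f
  let i : Stage (denseOpen X) :=
    ⟨ContinuousMap.setOfIdeal I, ContinuousMap.setOfIdeal_open I, dense_setOfIdeal hI⟩
  refine ⟨mk i F, fun a => ?_⟩
  rw [ofContinuous_eq_mk i, ofContinuous_eq_mk i, mk_mul]
  exact congrArg (mk i) (ContinuousMap.ext (hF a))

end

/-! ### The metric of `C[𝓢]` -/

section

variable {Y : Type u} [TopologicalSpace Y] {𝓢 : DenseFilterBase Y}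

namespace DenseFilterBase

/-- Closure of a base of dense sets under countable intersections: a countable family of elements of
`C[𝓢]` then has representatives on a common member of `𝓢`. -/
def IsCountablyClosed (𝓢 : DenseFilterBase Y) : Prop :=
  ∀ S : Set (Set Y), S.Countable → S ⊆ 𝓢.sets → ⋂₀ S ∈ 𝓢.sets

theorem IsCountablyClosed.iInter_mem {ι : Type*} [Countable ι] (h𝓢 : 𝓢.IsCountablyClosed)
    {S : ι → Set Y} (hS : ∀ i, S i ∈ 𝓢.sets) : ⋂ i, S i ∈ 𝓢.sets := by
  rw [← Set.sInter_range]
  exact h𝓢 _ (Set.countable_range S) (Set.range_subset_iff.2 hS)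

theorem isCountablyClosed_denseGdelta [BaireSpace Y] : (denseGdelta Y).IsCountablyClosed :=
  fun _ hS h => ⟨.sInter (fun _ hs => (h hs).1) hS,
    dense_sInter_of_Gδ (fun _ hs => (h hs).1) hS fun _ hs => (h hs).2⟩

end DenseFilterBase

namespace LimitRing

theorem exists_eq_mk (a : LimitRing 𝓢) : ∃ i f, a = mk i f := by
  induction a using ind with | h i f => exact ⟨i, f, rfl⟩

theorem mk_le_mk_iff {i j : Stage 𝓢} {f : C(i.carrier, ℝ)} {g : C(j.carrier, ℝ)} :
    mk i f ≤ mk j g ↔ ∀ y (hi : y ∈ i.carrier) (hj : y ∈ j.carrier), f ⟨y, hi⟩ ≤ g ⟨y, hj⟩ := by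
  let k : Stage 𝓢 := ⟨i.carrier ∩ j.carrier, 𝓢.inter_mem i.mem j.mem⟩
  rw [← mk_res (j := k) Set.inter_subset_left, ← mk_res (j := k) Set.inter_subset_right, mk_le_mk]
  exact ⟨fun h y hi hj => h ⟨y, hi, hj⟩, fun h y => h y.1 y.2.1 y.2.2⟩

theorem exists_forall_eq_mk (h𝓢 : 𝓢.IsCountablyClosed) (a : ℕ → LimitRing 𝓢) :
    ∃ (k : Stage 𝓢) (f : ℕ → C(k.carrier, ℝ)), ∀ n, a n = mk k (f n) := by
  choose i f hf using fun n => exists_eq_mk (a n)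
  let k : Stage 𝓢 := ⟨⋂ n, (i n).carrier, h𝓢.iInter_mem fun n => (i n).mem⟩
  have hik : ∀ n, i n ≤ k := fun n => Set.iInter_subset _ n
  exact ⟨k, fun n => res _ _ (hik n) (f n), fun n => by rw [mk_res, hf]⟩

variable (𝓢) in
/-- The constant functions in `C[𝓢]`. -/
def const : ℝ →+* LimitRing 𝓢 := ofContinuous.comp ContinuousMap.C

theorem const_eq_mk (i : Stage 𝓢) (r : ℝ) : const 𝓢 r = mk i (ContinuousMap.const _ r) :=
  ofContinuous_eq_mk i _

theorem mk_sub (i : Stage 𝓢) (f g : C(i.carrier, ℝ)) : mk i f - mk i g = mk i (f - g) := by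
  rw [sub_eq_add_neg, mk_neg, mk_add, sub_eq_add_neg]

theorem abs_mk_sub_mk_le_const_iff {i : Stage 𝓢} {f g : C(i.carrier, ℝ)} {δ : ℝ} :
    |mk i f - mk i g| ≤ const 𝓢 δ ↔ ∀ x, |f x - g x| ≤ δ := by
  simp only [abs_le', mk_sub, mk_neg, const_eq_mk i, mk_le_mk, ContinuousMap.le_def,
    ContinuousMap.sub_apply, ContinuousMap.neg_apply, ContinuousMap.const_apply, forall_and]

theorem dist_le_iff_abs_sub_le {a b : LimitRing 𝓢} {δ : ℝ} (hδ : 0 ≤ δ) :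
    dist a b ≤ δ / (1 + δ) ↔ |a - b| ≤ const 𝓢 δ := by
  induction a, b using ind₂ with | h i f g => ?_
  have hratio : ∀ t : ℝ, |t| / (1 + |t|) ≤ δ / (1 + δ) ↔ |t| ≤ δ := fun t => by
    rw [div_le_div_iff₀ (by positivity) (by positivity)]
    constructor <;> intro h <;> linarith
  rw [dist_mk, abs_mk_sub_mk_le_const_iff]
  refine ⟨fun h x => (hratio _).1 ((le_stageDist i f g x).trans h), fun h => ?_⟩
  exact stageDist_le i f g (by positivity) fun x => (hratio _).2 (h x)

theorem dist_lt_of_abs_sub_le {a b : LimitRing 𝓢} {δ : ℝ} (hδ : 0 < δ)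
    (h : |a - b| ≤ const 𝓢 δ) : dist a b < δ :=
  ((dist_le_iff_abs_sub_le hδ.le).2 h).trans_lt (div_lt_self hδ (by linarith))

theorem dist_le_one (a b : LimitRing 𝓢) : dist a b ≤ 1 := by
  induction a, b using ind₂ with | h i f g => ?_
  rw [dist_mk]
  exact stageDist_le i f g zero_le_one fun x => ratio_le_one _

theorem isometry_of_le_iff_le {X : Type u} [TopologicalSpace X] {𝓣 : DenseFilterBase X}
    (φ : LimitRing 𝓢 →+* LimitRing 𝓣) (hφ : ∀ a b, φ a ≤ φ b ↔ a ≤ b)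
    (hconst : ∀ r, φ (const 𝓢 r) = const 𝓣 r) : Isometry φ := by
  refine Isometry.of_dist_eq fun a b => eq_of_forall_ge_iff fun c => ?_
  rcases lt_or_ge c 0 with hc | hc
  · exact iff_of_false (fun h => (dist_nonneg.trans h).not_gt hc)
      fun h => (dist_nonneg.trans h).not_gt hc
  rcases le_or_gt 1 c with hc1 | hc1
  · exact iff_of_true ((dist_le_one _ _).trans hc1) ((dist_le_one _ _).trans hc1)
  obtain ⟨δ, hδ, rfl⟩ : ∃ δ : ℝ, 0 ≤ δ ∧ c = δ / (1 + δ) := by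
    have : 0 < 1 - c := sub_pos.2 hc1
    exact ⟨c / (1 - c), by positivity, by field_simp; ring⟩
  rw [dist_le_iff_abs_sub_le hδ, dist_le_iff_abs_sub_le hδ, abs_le', abs_le', ← hconst,
    ← map_sub, ← map_neg, hφ, hφ]

theorem completeSpace (h𝓢 : 𝓢.IsCountablyClosed) : CompleteSpace (LimitRing 𝓢) := by
  refine Metric.complete_of_cauchySeq_tendsto fun u hu => ?_
  obtain ⟨k, f, hf⟩ := exists_forall_eq_mk h𝓢 u
  have hunif : UniformCauchySeqOn (fun n => f n) Filter.atTop Set.univ :=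
    Metric.uniformCauchySeqOn_iff.2 fun ε hε => by
      obtain ⟨δ, hδ, hδε⟩ := exists_between hε
      obtain ⟨N, hN⟩ := Metric.cauchySeq_iff.1 hu (δ / (1 + δ)) (by positivity)
      refine ⟨N, fun m hm n hn x _ => lt_of_le_of_lt ?_ hδε⟩
      have hmn := (dist_le_iff_abs_sub_le hδ.le).1 (hN m hm n hn).le
      rw [hf, hf, abs_mk_sub_mk_le_const_iff] at hmn
      exact hmn x
  choose F hF using fun x =>
    cauchySeq_tendsto_of_complete (hunif.cauchySeq (Set.mem_univ x))
  have hlim : TendstoUniformly (fun n => f n) F Filter.atTop := tendstoUniformlyOn_univ.1 <|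
    hunif.tendstoUniformlyOn_of_tendsto fun x _ => hF x
  have hFcont : Continuous F := hlim.continuous (.of_forall fun n => (f n).continuous)
  refine ⟨mk k ⟨F, hFcont⟩, Metric.tendsto_atTop.2 fun ε hε => ?_⟩
  obtain ⟨N, hN⟩ := Filter.eventually_atTop.1 (Metric.tendstoUniformly_iff.1 hlim ε hε)
  refine ⟨N, fun n hn => dist_lt_of_abs_sub_le hε ?_⟩
  rw [hf, abs_mk_sub_mk_le_const_iff]
  intro x
  rw [abs_sub_comm]
  exact (hN n hn x).le

end LimitRing

end

/-! ### Dedekind completeness -/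

section

/-- The function cut out by a decreasing family of sets `U q`, which play the role of the sets
`{q < f}`. It has a junk value at the points that lie in all or in none of the `U q`. -/
def cutValue {Y : Type u} (U : ℝ → Set Y) (y : Y) : ℝ := sSup {q | y ∈ U q}

section

variable {Y : Type u} {U : ℝ → Set Y} {y : Y} {q r : ℝ}

theorem le_of_mem_of_notMem (hU : Antitone U) (hq : y ∈ U q) (hr : y ∉ U r) : q ≤ r :=
  le_of_not_ge fun h => hr (hU h hq)

theorem mem_of_lt_cutValue (hU : Antitone U) (hr : y ∈ U r) (h : q < cutValue U y) : y ∈ U q := by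
  obtain ⟨q', hq', hqq'⟩ := exists_lt_of_lt_csSup ⟨r, hr⟩ h
  exact hU hqq'.le hq'

theorem le_cutValue (hU : Antitone U) (hr : y ∉ U r) (hq : y ∈ U q) : q ≤ cutValue U y :=
  le_csSup ⟨r, fun _ hq' => le_of_mem_of_notMem hU hq' hr⟩ hq

theorem cutValue_le (hq : y ∈ U q) (h : ∀ p, y ∈ U p → p ≤ r) : cutValue U y ≤ r :=
  csSup_le ⟨q, hq⟩ h

end

variable {Y : Type u} [TopologicalSpace Y]

theorem continuousOn_cutValue {U : ℝ → Set Y} (hU : Antitone U) (hUo : ∀ q, IsOpen (U q))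
    {D : Set Y} (hmem : ∀ y ∈ D, ∃ q, y ∈ U q) (hnotMem : ∀ y ∈ D, ∃ q, y ∉ U q)
    (hfr : ∀ q : ℚ, ∀ y ∈ D, y ∉ frontier (U q)) : ContinuousOn (cutValue U) D := by
  intro y hy
  obtain ⟨q₀, hq₀⟩ := hmem y hy
  obtain ⟨r₀, hr₀⟩ := hnotMem y hy
  refine tendsto_order.2 ⟨fun a ha => ?_, fun b hb => ?_⟩
  · obtain ⟨q, haq, hqy⟩ := exists_between ha
    have hyq : U q ∈ nhds y := (hUo q).mem_nhds (mem_of_lt_cutValue hU hq₀ hqy)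
    filter_upwards [mem_nhdsWithin_of_mem_nhds hyq, self_mem_nhdsWithin] with z hzq hzD
    obtain ⟨r, hr⟩ := hnotMem z hzD
    exact haq.trans_le (le_cutValue hU hr hzq)
  · obtain ⟨q, hyq, hqb⟩ := exists_rat_btwn hb
    have hyU : y ∉ U q := fun h => (le_cutValue hU hr₀ h).not_gt hyq
    have hycl : y ∉ closure (U q) := fun h =>
      hfr q y hy ⟨h, fun hint => hyU (interior_subset hint)⟩
    have hynhds : (closure (U q))ᶜ ∈ nhds y := isClosed_closure.isOpen_compl.mem_nhds hycl
    filter_upwards [mem_nhdsWithin_of_mem_nhds hynhds, self_mem_nhdsWithin] with z hzq hzD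
    obtain ⟨p, hp⟩ := hmem z hzD
    have hzU : z ∉ U q := fun h => hzq (subset_closure h)
    exact (cutValue_le hp fun _ h => le_of_mem_of_notMem hU h hzU).trans_lt hqb

theorem dense_compl_frontier {O : Set Y} (hO : IsOpen O) : Dense (frontier O)ᶜ := by
  rw [← interior_eq_empty_iff_dense_compl, ← frontier_compl]
  exact interior_frontier hO.isClosed_compl

variable {𝓢 : DenseFilterBase Y}

namespace LimitRing

/-- The union of the open sets on which (some representative of) some member of `P` exceeds `q`
pointwise, a substitute for the set where the pointwise supremum of `P` exceeds `q`. -/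
def superlevel (P : Set (LimitRing 𝓢)) (q : ℝ) : Set Y :=
  ⋃₀ {O | IsOpen O ∧ ∃ i f, mk i f ∈ P ∧ ∀ z : i.carrier, z.1 ∈ O → q < f z}

variable {P : Set (LimitRing 𝓢)}

theorem isOpen_superlevel (P : Set (LimitRing 𝓢)) (q : ℝ) : IsOpen (superlevel P q) :=
  isOpen_sUnion fun _ hO => hO.1

theorem antitone_superlevel (P : Set (LimitRing 𝓢)) : Antitone (superlevel P) := fun _ _ hq =>
  Set.sUnion_subset_sUnion fun _ ⟨hO, i, f, hP, hf⟩ =>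
    ⟨hO, i, f, hP, fun z hz => hq.trans_lt (hf z hz)⟩

theorem mem_superlevel {i : Stage 𝓢} {f : C(i.carrier, ℝ)} (hf : mk i f ∈ P) {z : i.carrier} {q : ℝ}
    (h : q < f z) : z.1 ∈ superlevel P q := by
  obtain ⟨O, hO, hOf⟩ := isOpen_induced_iff.1 (isOpen_lt continuous_const f.continuous)
  exact ⟨O, ⟨hO, i, f, hf, fun w hw => hOf.subset hw⟩, hOf.superset h⟩

theorem le_of_mem_superlevel {j : Stage 𝓢} {g : C(j.carrier, ℝ)} (hg : mk j g ∈ upperBounds P)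
    {z : j.carrier} {q : ℝ} (hz : z.1 ∈ superlevel P q) : q ≤ g z := by
  obtain ⟨O, ⟨hO, i, f, hfP, hf⟩, hzO⟩ := hz
  by_contra! hlt
  obtain ⟨W, hW, hWg⟩ := isOpen_induced_iff.1 (isOpen_lt g.continuous continuous_const)
  obtain ⟨w, ⟨hwi, hwj⟩, hwO, hwW⟩ := (𝓢.dense (𝓢.inter_mem i.mem j.mem)).exists_mem_open
    (hO.inter hW) ⟨z, hzO, hWg.superset hlt⟩
  have hgw : g ⟨w, hwj⟩ < q := hWg.subset hwW
  exact ((hf ⟨w, hwi⟩ hwO).trans_le (mk_le_mk_iff.1 (hg hfP) w hwi hwj)).not_gt hgw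

theorem exists_isLUB (h𝓢 : 𝓢.IsCountablyClosed) (hopen : (denseOpen Y).sets ⊆ 𝓢.sets)
    (hne : P.Nonempty) (hbdd : BddAbove P) : ∃ s, IsLUB P s := by
  obtain ⟨a₀, ha₀⟩ := hne
  obtain ⟨b₀, hb₀⟩ := hbdd
  obtain ⟨i, f, rfl⟩ := exists_eq_mk a₀
  obtain ⟨j, g, rfl⟩ := exists_eq_mk b₀
  have hfr : ⋂ q : ℚ, (frontier (superlevel P q))ᶜ ∈ 𝓢.sets := h𝓢.iInter_mem fun q =>
    hopen ⟨isClosed_frontier.isOpen_compl, dense_compl_frontier (isOpen_superlevel P q)⟩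
  let D : Stage 𝓢 := ⟨(i.carrier ∩ j.carrier) ∩ ⋂ q : ℚ, (frontier (superlevel P q))ᶜ,
    𝓢.inter_mem (𝓢.inter_mem i.mem j.mem) hfr⟩
  have hmem : ∀ y ∈ D.carrier, ∃ q, y ∈ superlevel P q := fun y hy =>
    ⟨_, mem_superlevel ha₀ (z := ⟨y, hy.1.1⟩) (sub_one_lt _)⟩
  have hnotMem : ∀ y ∈ D.carrier, ∃ q, y ∉ superlevel P q := fun y hy =>
    ⟨_, fun h => (le_of_mem_superlevel hb₀ (z := ⟨y, hy.1.2⟩) h).not_gt (lt_add_one _)⟩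
  have hcont : ContinuousOn (cutValue (superlevel P)) D.carrier :=
    continuousOn_cutValue (antitone_superlevel P) (isOpen_superlevel P) hmem hnotMem
      fun q y hy => Set.mem_iInter.1 hy.2 q
  refine ⟨mk D ⟨_, hcont.domRestrict⟩, fun a ha => ?_, fun b hb => ?_⟩
  · obtain ⟨i', f', rfl⟩ := exists_eq_mk a
    refine mk_le_mk_iff.2 fun y hi hD => le_of_forall_lt fun q hq => ?_
    obtain ⟨q', hqq', hq'⟩ := exists_between hq
    obtain ⟨r, hr⟩ := hnotMem y hD
    exact hqq'.trans_le (le_cutValue (antitone_superlevel P) hr (mem_superlevel ha hq'))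
  · obtain ⟨j', g', rfl⟩ := exists_eq_mk b
    refine mk_le_mk_iff.2 fun y hD hj => ?_
    obtain ⟨q, hq⟩ := hmem y hD
    exact cutValue_le hq fun p hp => le_of_mem_superlevel hb (z := ⟨y, hj⟩) hp

end LimitRing

end

/-! ### Order density -/

section

open LimitRing

variable {Y : Type u} [TopologicalSpace Y] {𝓢 : DenseFilterBase Y}

/-- `e` is a cut-off function for `O`: it takes values in `[0, 1]`, vanishes off `O` and is equal to
`1` on some nonempty open set. -/
def IsBump (e : LimitRing 𝓢) (O : Set Y) : Prop :=
  ∃ i f, e = mk i f ∧ (∀ z, f z ∈ Set.Icc 0 1) ∧ (∀ z : i.carrier, z.1 ∉ O → f z = 0) ∧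
    ∃ O' : Set Y, IsOpen O' ∧ O'.Nonempty ∧ ∀ z : i.carrier, z.1 ∈ O' → f z = 1

/-- A subring of `C[𝓢]` that contains the constants and a cut-off function for every nonempty open
set. This is what makes its elements order dense. -/
structure HasBumps (R : Subring (LimitRing 𝓢)) : Prop where
  const_mem : ∀ r, const 𝓢 r ∈ R
  exists_isBump : ∀ O : Set Y, IsOpen O → O.Nonempty → ∃ e ∈ R, IsBump e O

namespace HasBumps

variable {R R' : Subring (LimitRing 𝓢)}

theorem mono (hR : HasBumps R) (h : R ≤ R') : HasBumps R' where
  const_mem r := h (hR.const_mem r)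
  exists_isBump O hO hne := (hR.exists_isBump O hO hne).imp fun _ he => ⟨h he.1, he.2⟩

theorem exists_mem_le_not_le (hR : HasBumps R) {g b v : LimitRing 𝓢} (hg : g ∈ R) (hgb : g ≤ b)
    (hbv : ¬b ≤ v) : ∃ a ∈ R, a ≤ b ∧ ¬a ≤ v := by
  induction g, b, v using ind₃ with | h i g b v => ?_
  obtain ⟨x, hx⟩ : ∃ x, v x < b x := by simpa [mk_le_mk, ContinuousMap.le_def] using hbv
  obtain ⟨r, hvr, hrb⟩ := exists_between hx
  obtain ⟨O, hO, hOr⟩ := isOpen_induced_iff.1 <|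
    (isOpen_lt v.continuous continuous_const).inter (isOpen_lt continuous_const b.continuous)
  obtain ⟨_, heR, j, e, rfl, he01, he0, O', hO', hne, he1⟩ :=
    hR.exists_isBump O hO ⟨x, hOr.superset ⟨hvr, hrb⟩⟩
  let k : Stage 𝓢 := ⟨i.carrier ∩ j.carrier, 𝓢.inter_mem i.mem j.mem⟩
  have hik : i ≤ k := Set.inter_subset_left
  have hjk : j ≤ k := Set.inter_subset_right
  refine ⟨(1 - .mk j e) * .mk i g + .mk j e * const 𝓢 r,
    add_mem (mul_mem (sub_mem (one_mem R) heR) hg) (mul_mem heR (hR.const_mem r)), ?_⟩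
  rw [← mk_res hik, ← mk_res hik, ← mk_res hik, ← mk_res hjk, ← mk_one k, const_eq_mk k, mk_sub,
    mk_mul, mk_mul, mk_add, mk_le_mk, mk_le_mk]
  refine ⟨fun z => ?_, fun hle => ?_⟩
  · change (1 - e ⟨z, z.2.2⟩) * g ⟨z, z.2.1⟩ + e ⟨z, z.2.2⟩ * r ≤ b ⟨z, z.2.1⟩
    have hgbz : g ⟨z, z.2.1⟩ ≤ b ⟨z, z.2.1⟩ := mk_le_mk.1 hgb _
    by_cases hz : z.1 ∈ O
    · have hrbz : r < b ⟨z, z.2.1⟩ := ((Set.ext_iff.1 hOr _).1 hz).2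
      exact convex_Iic (b _) hgbz hrbz.le (sub_nonneg.2 (he01 _).2) (he01 _).1
        (sub_add_cancel 1 _)
    · rw [he0 _ hz]
      linarith
  · obtain ⟨w, hwk, hwO'⟩ := (𝓢.dense k.mem).exists_mem_open hO' hne
    have hew : e ⟨w, hwk.2⟩ = 1 := he1 _ hwO'
    have hwO : w ∈ O := by
      by_contra h
      exact zero_ne_one ((he0 ⟨w, hwk.2⟩ h).symm.trans hew)
    have hvrw : v ⟨w, hwk.1⟩ < r := ((Set.ext_iff.1 hOr _).1 hwO).1
    have hrv : (1 - e ⟨w, hwk.2⟩) * g ⟨w, hwk.1⟩ + e ⟨w, hwk.2⟩ * r ≤ v ⟨w, hwk.1⟩ := hle ⟨w, hwk⟩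
    rw [hew] at hrv
    linarith

theorem isLUB (hR : HasBumps R) {g b : LimitRing 𝓢} (hg : g ∈ R) (hgb : g ≤ b) :
    IsLUB {a | a ∈ R ∧ a ≤ b} b := by
  refine ⟨fun a ha => ha.2, fun v hv => ?_⟩
  by_contra hbv
  obtain ⟨a, haR, hab, hav⟩ := hR.exists_mem_le_not_le hg hgb hbv
  exact hav (hv ⟨haR, hab⟩)

theorem isDedekindCompletion {A B : Type u} [CommRing A] [PartialOrder A] [CommRing B]
    [PartialOrder B] (h𝓢 : 𝓢.IsCountablyClosed) (hopen : (denseOpen Y).sets ⊆ 𝓢.sets)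
    {φ : A →+* B} {ι : B →+* LimitRing 𝓢} (hR : HasBumps (ι.comp φ).range)
    (hφ : ∀ a a', φ a ≤ φ a' ↔ a ≤ a') (hι : ∀ b b', ι b ≤ ι b' ↔ b ≤ b')
    (hconv : (Set.range ι).OrdConnected) (hle : ∀ b, ∃ a, φ a ≤ b) : IsDedekindCompletion φ := by
  refine ⟨hφ, fun P hne ⟨u, hu⟩ => ?_, fun b => ?_⟩
  · have hιu : ι u ∈ upperBounds (ι '' P) := by
      rintro _ ⟨p, hp, rfl⟩
      exact (hι p u).2 (hu hp)
    obtain ⟨s, hs⟩ := exists_isLUB h𝓢 hopen (hne.image ι) ⟨_, hιu⟩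
    obtain ⟨p, hp⟩ := hne
    obtain ⟨t, rfl⟩ := hconv.out ⟨p, rfl⟩ ⟨u, rfl⟩ ⟨hs.1 ⟨p, hp, rfl⟩, hs.2 hιu⟩
    exact ⟨t, IsLUB.of_image (hι _ _) hs⟩
  · obtain ⟨a₀, ha₀⟩ := hle b
    have himage : ι '' (φ '' {a | φ a ≤ b}) = {c | c ∈ (ι.comp φ).range ∧ c ≤ ι b} := by
      ext c
      constructor
      · rintro ⟨_, ⟨a, ha, rfl⟩, rfl⟩
        exact ⟨⟨a, rfl⟩, (hι _ b).2 ha⟩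
      · rintro ⟨⟨a, rfl⟩, ha⟩
        exact ⟨_, ⟨a, (hι _ b).1 ha, rfl⟩, rfl⟩
    exact ⟨{a | φ a ≤ b}, IsLUB.of_image (hι _ _) <|
      himage ▸ hR.isLUB ⟨a₀, rfl⟩ ((hι _ b).2 ha₀)⟩

end HasBumps

end

/-! ### Approximation by locally constant functions -/

section

variable {Y : Type u} [TopologicalSpace Y]

theorem exists_pairwiseDisjoint_dense_sUnion {𝒪 : Set (Set Y)} (hopen : ∀ O ∈ 𝒪, IsOpen O)
    (hsub : ∀ O ∈ 𝒪, ∀ O' ⊆ O, IsOpen O' → O' ∈ 𝒪) (hd : Dense (⋃₀ 𝒪)) :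
    ∃ 𝓕 ⊆ 𝒪, 𝓕.PairwiseDisjoint id ∧ Dense (⋃₀ 𝓕) := by
  obtain ⟨𝓕, h𝓕⟩ := zorn_subset {𝓕 : Set (Set Y) | 𝓕 ⊆ 𝒪 ∧ 𝓕.PairwiseDisjoint id}
    fun c hc hchain => ⟨⋃₀ c, ⟨Set.sUnion_subset fun s hs => (hc hs).1,
      (Set.pairwiseDisjoint_sUnion hchain.directedOn).2 fun s hs => (hc hs).2⟩,
      fun s hs => Set.subset_sUnion_of_mem hs⟩
  refine ⟨𝓕, h𝓕.prop.1, h𝓕.prop.2, dense_iff_inter_open.2 fun V hV hne => ?_⟩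
  obtain ⟨y, hyV, O, hO, hyO⟩ := hd.inter_open_nonempty V hV hne
  by_contra hempty
  have hdisj : ∀ W ∈ 𝓕, Disjoint (V ∩ O) W := fun W hW =>
    Set.disjoint_left.2 fun z hz hzW => hempty ⟨z, hz.1, W, hW, hzW⟩
  have hmem : V ∩ O ∈ 𝓕 := h𝓕.le_of_ge (y := insert (V ∩ O) 𝓕)
    ⟨Set.insert_subset (hsub O hO _ Set.inter_subset_right (hV.inter (hopen O hO))) h𝓕.prop.1,
      h𝓕.prop.2.insert fun W hW _ => hdisj W hW⟩ (Set.subset_insert _ _) (Set.mem_insert _ _)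
  exact hempty ⟨y, hyV, _, hmem, hyV, hyO⟩

theorem exists_isLocallyConstant_sUnion {𝓕 : Set (Set Y)} (hopen : ∀ O ∈ 𝓕, IsOpen O)
    (hdisj : 𝓕.PairwiseDisjoint id) {α : Type*} (c : Set Y → α) :
    ∃ g : ⋃₀ 𝓕 → α, IsLocallyConstant g ∧ ∀ O ∈ 𝓕, ∀ z : ⋃₀ 𝓕, z.1 ∈ O → g z = c O := by
  choose T hT hmem using fun z : ⋃₀ 𝓕 => z.2
  have hcT : ∀ O ∈ 𝓕, ∀ z : ⋃₀ 𝓕, z.1 ∈ O → c (T z) = c O := fun O hO z hz =>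
    congrArg c (hdisj.elim_set (hT z) hO z.1 (hmem z) hz)
  refine ⟨fun z => c (T z), (IsLocallyConstant.iff_exists_open _).2 fun z => ?_, hcT⟩
  exact ⟨Subtype.val ⁻¹' T z, (hopen _ (hT z)).preimage continuous_subtype_val, hmem z,
    hcT _ (hT z)⟩

theorem exists_isLocallyConstant_abs_sub_le {S : Set Y} (hS : Dense S) (f : C(S, ℝ)) {ε : ℝ}
    (hε : 0 < ε) : ∃ (j : Stage (denseOpen Y)) (g : C(j.carrier, ℝ)), IsLocallyConstant g ∧
      ∀ y (hi : y ∈ S) (hj : y ∈ j.carrier), |f ⟨y, hi⟩ - g ⟨y, hj⟩| ≤ ε := by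
  let 𝒪 : Set (Set Y) := {O | IsOpen O ∧ ∃ c : ℝ, ∀ z : S, z.1 ∈ O → |f z - c| ≤ ε}
  have hd : Dense (⋃₀ 𝒪) := hS.mono fun y hy => by
    obtain ⟨O, hO, hOf⟩ := isOpen_induced_iff.1 <|
      (Metric.isOpen_ball (x := f ⟨y, hy⟩) (ε := ε)).preimage f.continuous
    have hmem : ∀ z : S, z.1 ∈ O ↔ |f z - f ⟨y, hy⟩| < ε := Set.ext_iff.1 hOf
    exact ⟨O, ⟨hO, f ⟨y, hy⟩, fun z hz => ((hmem z).1 hz).le⟩, (hmem ⟨y, hy⟩).2 (by simpa using hε)⟩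
  obtain ⟨𝓕, h𝓕, hdisj, h𝓕d⟩ := exists_pairwiseDisjoint_dense_sUnion (𝒪 := 𝒪)
    (fun O hO => hO.1)
    (fun O hO O' h ho => ⟨ho, hO.2.imp fun c hc z hz => hc z (h hz)⟩) hd
  have hopen : ∀ O ∈ 𝓕, IsOpen O := fun O hO => (h𝓕 hO).1
  choose! c hc using fun O (hO : O ∈ 𝓕) => (h𝓕 hO).2
  obtain ⟨g, hg, hgc⟩ := exists_isLocallyConstant_sUnion hopen hdisj c
  refine ⟨⟨⋃₀ 𝓕, isOpen_sUnion hopen, h𝓕d⟩, ⟨g, hg.continuous⟩, hg, fun y hi hj => ?_⟩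
  obtain ⟨O, hO, hyO⟩ := hj
  change |f ⟨y, hi⟩ - g ⟨y, O, hO, hyO⟩| ≤ ε
  rw [hgc O hO ⟨y, O, hO, hyO⟩ hyO]
  exact hc O hO ⟨y, hi⟩ hyO

end

/-! ### `Q(X)` and `C(X)` in `Q̄(X)` -/

section

open LimitRing

theorem ordConnected_boundedElements (A : Type u) [CommRing A] [PartialOrder A]
    [IsOrderedRing A] : (boundedElements A : Set A).OrdConnected := by
  refine ⟨fun a ⟨m, hm, _⟩ c ⟨n, _, hn⟩ b hb => ⟨m + n, ?_, ?_⟩⟩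
  · rw [Nat.cast_add]
    exact (neg_le_neg (le_add_of_nonneg_right n.cast_nonneg)).trans (hm.trans hb.1)
  · rw [Nat.cast_add]
    exact (hb.2.trans hn).trans (le_add_of_nonneg_left m.cast_nonneg)

variable {X : Type u} [TopologicalSpace X]

theorem QF_le_QL : QF X ≤ QL X := by
  rintro _ ⟨i, f, hf, rfl⟩
  have : Finite (Set.range f) := hf
  have hrange : IsLocallyConstant (Set.rangeFactorization f) :=
    (IsLocallyConstant.iff_continuous _).2 (f.continuous.subtype_mk _)
  exact ⟨i, f, hrange.comp Subtype.val, rfl⟩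

theorem const_mem_QF (r : ℝ) : const _ r ∈ QF X :=
  ⟨_, _, (Set.finite_singleton r).subset (Set.range_subset_iff.2 fun _ => rfl), rfl⟩

theorem inclQ_le_iff {a b : Q (StoneCech X)} : inclQ X a ≤ inclQ X b ↔ a ≤ b := by
  induction a, b using ind₂ with | h i f g => ?_
  rw [mk_le_mk]
  exact mk_le_mk

theorem isDedekindCompletion_of_hasBumps {A B : Type u} [CommRing A] [PartialOrder A] [CommRing B]
    [PartialOrder B] {φ : A →+* B} {ι : B →+* Qbar X} (hR : HasBumps (ι.comp φ).range)
    (hφ : ∀ a a', φ a ≤ φ a' ↔ a ≤ a') (hι : ∀ b b', ι b ≤ ι b' ↔ b ≤ b')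
    (hconv : (Set.range ι).OrdConnected) (hle : ∀ b, ∃ a, φ a ≤ b) : IsDedekindCompletion φ :=
  hR.isDedekindCompletion DenseFilterBase.isCountablyClosed_denseGdelta
    (fun _ hS => ⟨hS.1.isGδ, hS.2⟩) hφ hι hconv hle

variable [T35Space X]

theorem ordConnected_CBounded : (CBounded X : Set (Qbar X)).OrdConnected := by
  refine ⟨fun a ⟨g, hg⟩ c ⟨k, hk⟩ b hb => ⟨g + k, ?_⟩⟩
  have hg0 := (abs_nonneg a).trans hg
  have hk0 := (abs_nonneg c).trans hk
  rw [map_add]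
  rw [abs_le'] at hg hk ⊢
  exact ⟨(hb.2.trans hk.1).trans (le_add_of_nonneg_left hg0),
    ((neg_le_neg hb.1).trans hg.2).trans (le_add_of_nonneg_right hk0)⟩

theorem toQbar_restrictQ (a : Q (StoneCech X)) : toQbar X (restrictQ X a) = inclQ X a :=
  congrArg (inclQ X)
    ((RingEquiv.ofBijective (restrictQ X) restrictQ_bijective).symm_apply_apply a)

theorem toQbar_le_iff {a b : Q X} : toQbar X a ≤ toQbar X b ↔ a ≤ b := by
  obtain ⟨a, rfl⟩ := restrictQ_bijective.2 a
  obtain ⟨b, rfl⟩ := restrictQ_bijective.2 b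
  rw [toQbar_restrictQ, toQbar_restrictQ, restrictQ_le_iff, inclQ_le_iff]

theorem continuousToQbar_le_iff {f g : C(X, ℝ)} :
    continuousToQbar X f ≤ continuousToQbar X g ↔ f ≤ g :=
  toQbar_le_iff.trans ofContinuous_le_ofContinuous

theorem continuousToQbar_comp_stoneCechUnit (f : C(StoneCech X, ℝ)) :
    continuousToQbar X (f.comp ⟨stoneCechUnit, continuous_stoneCechUnit⟩) = ofContinuous f :=
  toQbar_restrictQ (ofContinuous f)

theorem toQbar_const (r : ℝ) : toQbar X (const _ r) = const _ r :=
  continuousToQbar_comp_stoneCechUnit (ContinuousMap.const _ r)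

theorem restrictQ_mk_mem_QL {j : Stage (denseOpen (StoneCech X))} {g : C(j.carrier, ℝ)}
    (hg : IsLocallyConstant g) : restrictQ X (mk j g) ∈ QL X :=
  ⟨_, _, hg.comp_continuous continuous_stoneCechUnit.restrictPreimage, rfl⟩

theorem restrictQ_mk_mem_QF {j : Stage (denseOpen (StoneCech X))} {g : C(j.carrier, ℝ)}
    (hg : (Set.range g).Finite) : restrictQ X (mk j g) ∈ QF X :=
  ⟨_, _, hg.subset (Set.range_comp_subset_range (Set.restrictPreimage _ _) g), rfl⟩

theorem exists_mem_QL_abs_sub_toQbar_le (b : Qbar X) {ε : ℝ} (hε : 0 < ε) :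
    ∃ a ∈ QL X, |b - toQbar X a| ≤ const _ ε := by
  obtain ⟨i, f, rfl⟩ := exists_eq_mk b
  obtain ⟨j, g, hg, hfg⟩ := exists_isLocallyConstant_abs_sub_le i.mem.2 f hε
  let j' : Stage (denseGdelta (StoneCech X)) := ⟨j.carrier, j.mem.1.isGδ, j.mem.2⟩
  let k : Stage (denseGdelta (StoneCech X)) :=
    ⟨i.carrier ∩ j.carrier, (denseGdelta _).inter_mem i.mem j'.mem⟩
  have hik : i ≤ k := Set.inter_subset_left
  have hjk : j' ≤ k := Set.inter_subset_right
  have hincl : inclQ X (mk j g) = mk k (res j' k hjk g) := (mk_res hjk g).symm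
  refine ⟨_, restrictQ_mk_mem_QL hg, ?_⟩
  rw [toQbar_restrictQ, hincl, ← mk_res hik f, abs_mk_sub_mk_le_const_iff]
  exact fun z => hfg z z.2.1 z.2.2

theorem isometry_toQbar : Isometry (toQbar X) :=
  isometry_of_le_iff_le _ (fun _ _ => toQbar_le_iff) toQbar_const

theorem isMetricCompletion_toQbar : IsMetricCompletion (toQbar X) where
  isometry := isometry_toQbar
  denseRange := Metric.dense_iff.2 fun b ε hε => by
    obtain ⟨a, -, ha⟩ := exists_mem_QL_abs_sub_toQbar_le b hε
    exact ⟨toQbar X a, (dist_comm _ _).trans_lt (dist_lt_of_abs_sub_le hε ha), a, rfl⟩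
  complete := completeSpace DenseFilterBase.isCountablyClosed_denseGdelta

/-! ### Dedekind completions -/

theorem hasBumps_QF : HasBumps ((QF X).map (toQbar X)) where
  const_mem r := ⟨_, const_mem_QF r, toQbar_const r⟩
  exists_isBump O hO hne := by
    let j : Stage (denseOpen (StoneCech X)) :=
      ⟨(frontier O)ᶜ, isClosed_frontier.isOpen_compl, dense_compl_frontier hO⟩
    have hclopen : IsClopen (Subtype.val ⁻¹' O : Set j.carrier) :=
      isClopen_preimage_val hO disjoint_compl_right
    let e : C(j.carrier, ℝ) := (LocallyConstant.charFn ℝ hclopen : C(_, ℝ))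
    have he1 : ∀ z : j.carrier, z.1 ∈ O → e z = 1 := fun z =>
      (LocallyConstant.charFn_eq_one ℝ z hclopen).2
    have he0 : ∀ z : j.carrier, z.1 ∉ O → e z = 0 := fun z =>
      (LocallyConstant.charFn_eq_zero ℝ z hclopen).2
    have he : ∀ z, e z ∈ ({0, 1} : Set ℝ) := fun z =>
      (em (z.1 ∈ O)).elim (fun hz => .inr (he1 z hz)) fun hz => .inl (he0 z hz)
    have hfin : (Set.range e).Finite := (Set.toFinite {0, 1}).subset (Set.range_subset_iff.2 he)
    have h01 : ({0, 1} : Set ℝ) ⊆ Set.Icc 0 1 :=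
      Set.pair_subset (Set.left_mem_Icc.2 zero_le_one) (Set.right_mem_Icc.2 zero_le_one)
    exact ⟨_, ⟨_, restrictQ_mk_mem_QF hfin, toQbar_restrictQ _⟩, _, _, rfl,
      fun z => h01 (he z), fun z => he0 z, O, hO, hne, fun z => he1 z⟩

theorem hasBumps_CStar : HasBumps ((CStar X).map (continuousToQbar X)) where
  const_mem r := by
    obtain ⟨m, hm⟩ := exists_nat_ge |r|
    rw [abs_le] at hm
    exact ⟨ContinuousMap.const X r, ⟨m, fun x => by simpa using hm.1, fun x => by simpa using hm.2⟩,
      toQbar_const r⟩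
  exists_isBump O hO hne := by
    obtain ⟨x, hx⟩ := hne
    obtain ⟨e, he01, hesupp, O', hO', hxO', he1⟩ := exists_bump hO hx
    refine ⟨_, ⟨e.comp ⟨stoneCechUnit, continuous_stoneCechUnit⟩, ⟨1, fun y => ?_, fun y => ?_⟩,
      continuousToQbar_comp_stoneCechUnit e⟩, _, _, rfl, fun z => he01 z, fun z hz => ?_,
      O', hO', ⟨x, hxO'⟩, fun z hz => he1 hz⟩
    · simpa using (neg_nonpos.2 zero_le_one).trans (he01 (stoneCechUnit y)).1
    · simpa using (he01 (stoneCechUnit y)).2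
    · exact image_eq_zero_of_notMem_tsupport (f := e) fun h => hz (hesupp h)

theorem exists_mem_QL_le (b : Qbar X) : ∃ a ∈ QL X, toQbar X a ≤ b := by
  obtain ⟨a, ha, hab⟩ := exists_mem_QL_abs_sub_toQbar_le b one_pos
  refine ⟨a - 1, sub_mem ha (one_mem _), ?_⟩
  rw [map_sub, map_one, sub_le_iff_le_add']
  have := (abs_le'.1 hab).2
  rw [map_one, neg_sub] at this
  exact sub_le_iff_le_add.1 this

theorem exists_mem_QF_le (b : QbarStar X) : ∃ a ∈ QF X, toQbar X a ≤ b := by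
  obtain ⟨m, hm, _⟩ := b.2
  exact ⟨-m, neg_mem (natCast_mem _ m), by rwa [map_neg, map_natCast]⟩

theorem isDedekindCompletion_qlToQbar : IsDedekindCompletion (qlToQbar X) := by
  refine isDedekindCompletion_of_hasBumps (ι := RingHom.id _) (hasBumps_QF.mono ?_)
    (fun _ _ => toQbar_le_iff) (fun _ _ => Iff.rfl) (by simpa using Set.ordConnected_univ)
    fun b => ?_
  · rintro _ ⟨a, ha, rfl⟩
    exact ⟨⟨a, QF_le_QL ha⟩, rfl⟩
  · obtain ⟨a, ha, hab⟩ := exists_mem_QL_le b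
    exact ⟨⟨a, ha⟩, hab⟩

theorem isDedekindCompletion_toQbar : IsDedekindCompletion (toQbar X) := by
  refine isDedekindCompletion_of_hasBumps (ι := RingHom.id _) (hasBumps_QF.mono ?_)
    (fun _ _ => toQbar_le_iff) (fun _ _ => Iff.rfl) (by simpa using Set.ordConnected_univ)
    fun b => ?_
  · rintro _ ⟨a, _, rfl⟩
    exact ⟨a, rfl⟩
  · exact (exists_mem_QL_le b).imp fun _ ha => ha.2

theorem isDedekindCompletion_qfToQbarStar : IsDedekindCompletion (qfToQbarStar X) := by
  refine isDedekindCompletion_of_hasBumps (ι := (QbarStar X).subtype) (hasBumps_QF.mono ?_)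
    (fun _ _ => toQbar_le_iff) (fun _ _ => Iff.rfl)
    (by simpa using ordConnected_boundedElements (Qbar X)) fun b => ?_
  · rintro _ ⟨a, ha, rfl⟩
    exact ⟨⟨a, ha⟩, rfl⟩
  · obtain ⟨a, ha, hab⟩ := exists_mem_QF_le b
    exact ⟨⟨a, ha⟩, hab⟩

theorem isDedekindCompletion_qstarToQbarStar : IsDedekindCompletion (qstarToQbarStar X) := by
  refine isDedekindCompletion_of_hasBumps (ι := (QbarStar X).subtype) (hasBumps_QF.mono ?_)
    (fun _ _ => toQbar_le_iff) (fun _ _ => Iff.rfl)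
    (by simpa using ordConnected_boundedElements (Qbar X)) fun b => ?_
  · rintro _ ⟨a, ha, rfl⟩
    exact ⟨⟨a, QF_le_Qstar ha⟩, rfl⟩
  · obtain ⟨a, ha, hab⟩ := exists_mem_QF_le b
    exact ⟨⟨a, QF_le_Qstar ha⟩, hab⟩

theorem isDedekindCompletion_continuousToCBounded :
    IsDedekindCompletion (continuousToCBounded X) := by
  refine isDedekindCompletion_of_hasBumps (ι := (CBounded X).subtype) (hasBumps_CStar.mono ?_)
    (fun _ _ => continuousToQbar_le_iff) (fun _ _ => Iff.rfl)
    (by simpa using ordConnected_CBounded) fun b => ?_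
  · rintro _ ⟨f, _, rfl⟩
    exact ⟨f, rfl⟩
  · obtain ⟨g, hg⟩ := b.2
    refine ⟨-g, ?_⟩
    change continuousToQbar X (-g) ≤ b
    rw [map_neg]
    exact neg_le.1 (abs_le'.1 hg).2

theorem isDedekindCompletion_cstarToQbarStar : IsDedekindCompletion (cstarToQbarStar X) := by
  refine isDedekindCompletion_of_hasBumps (ι := (QbarStar X).subtype) (hasBumps_CStar.mono ?_)
    (fun _ _ => continuousToQbar_le_iff) (fun _ _ => Iff.rfl)
    (by simpa using ordConnected_boundedElements (Qbar X)) fun b => ?_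
  · rintro _ ⟨f, hf, rfl⟩
    exact ⟨⟨f, hf⟩, rfl⟩
  · obtain ⟨m, hm, _⟩ := b.2
    refine ⟨⟨-m, neg_mem (natCast_mem _ m)⟩, ?_⟩
    change continuousToQbar X (-m) ≤ b
    rwa [map_neg, map_natCast]

end

end

end RingsOfFunctions

theorem mainTheorem5 (X : Type*) [TopologicalSpace X] [T35Space X] :
    -- the rings `Q(X)` and `Q̄(X)`
    RingsOfFunctions.IsMaximalRingOfQuotients
        (RingsOfFunctions.LimitRing.ofContinuous : C(X, ℝ) →+* RingsOfFunctions.Q X) ∧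
      RingsOfFunctions.IsMetricCompletion (RingsOfFunctions.toQbar X) ∧
    -- `Q̄(X)` is the Dedekind completion of `Q_L(X)` and of `Q(X)`
      RingsOfFunctions.IsDedekindCompletion (RingsOfFunctions.qlToQbar X) ∧
      RingsOfFunctions.IsDedekindCompletion (RingsOfFunctions.toQbar X) ∧
    -- `Q̄*(X)` is the Dedekind completion of `Q_F(X)` and of `Q*(X)`
      RingsOfFunctions.IsDedekindCompletion (RingsOfFunctions.qfToQbarStar X) ∧
      RingsOfFunctions.IsDedekindCompletion (RingsOfFunctions.qstarToQbarStar X) ∧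
    -- the Dedekind completions of `C(X)` and of `C*(X)`
      RingsOfFunctions.IsDedekindCompletion (RingsOfFunctions.continuousToCBounded X) ∧
      RingsOfFunctions.IsDedekindCompletion (RingsOfFunctions.cstarToQbarStar X) := by
  open RingsOfFunctions in
  exact ⟨isMaximalRingOfQuotients_ofContinuous, isMetricCompletion_toQbar,
    isDedekindCompletion_qlToQbar, isDedekindCompletion_toQbar,
    isDedekindCompletion_qfToQbarStar, isDedekindCompletion_qstarToQbarStar,
    isDedekindCompletion_continuousToCBounded, isDedekindCompletion_cstarToQbarStar⟩
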